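/- **Model.** Let $N$, $1\le K<N/2$ and $T\ge 1$ be integers and $\mathrm{SNR}>0$. One observes a $T\times N$ matrix $X$ and the vector $Y=X\beta+W\in\mathbb R^T$. The entries of $X$ are IID $\mathcal N(0,1/T)$, the entries of $W$ are IID $\mathcal N(0,1/\mathrm{SNR})$, the support $S$ of $\beta$ is uniformly distributed over the $K$-element subsets of $\{1,\dots,N\}$, and the coefficients $(\beta_k)_{k\in S}$ are IID with mean $0$ and variance $\sigma^2>0$; $X$, $W$, $S$ and the coefficients are independent. A decoder is a measurable map $\hat S(X,Y)$ (it may depend on $N,K,T,\mathrm{SNR}$ and the law of the coefficients), and $P(E)=\Pr[\hat S(X,Y)\neq S]$ is its error probability. Let $N\to\infty$, where $K$, $T$ and $\mathrm{SNR}$ are functions of $N$ (with $1\le K<N/2$, $T\ge1$ and $\mathrm{SNR}>0$ for all large $N$), the law of the coefficients being fixed. A condition (a property of $N$) is *necessary* for recovery if there is $\delta>0$ such that, for every sequence of decoders, $P(E)\ge\delta$ for all sufficiently large $N$ at which the condition fails. It is *sufficient* if there is a sequence of decoders such that for every $\varepsilon>0$, $P(E)<\varepsilon$ for all sufficiently large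 $N$ at which the condition holds. **Theorem.** 1. ($\mathrm{SNR}=\Omega(\log N)$ is necessary.) There is a universal constant $c>0$ such that, for every law of the coefficients and all scalings of $K$, $T$ and $\mathrm{SNR}$, the condition $\mathrm{SNR}\ge \frac{c}{\sigma^2}\log N$ is necessary for recovery. 2. (Necessary number of samples.) For every $A>0$ there is $c>0$, depending only on $A$, such that, for every law of the coefficients and all scalings of $K$, $T$ and $\mathrm{SNR}$ with $\mathrm{SNR}\le A\log(N/K)$ for all large $N$, the condition $$T\ \ge\ c\,\frac{K\log(N/K)}{\log(1+\sigma^2)}$$ is necessary for recovery. In the sublinear regime $K\le N^{1-\eta}$ with $\eta>0$ fixed, the same holds under the assumption $\mathrm{SNR}\le A\log N$, with $c>0$ depending only on $A$ and $\eta$. 3. (Sufficient number of samples.) There is a universal constant $C>0$ such that for every $b_{\min}>0$ there is $a>0$, depending only on $b_{\min}$, with the following property. If the coefficients satisfy $|\beta_k|\ge b_{\min}$ almost surely, $K\ge 1$ is fixed, and $\mathrm{SNR}\ge a\log N$ for all large $N$, then the condition $$T\ \ge\ C\,\frac{K\log(N/K)}{\log(1+b_{\min}^2)}$$ is sufficient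 for recovery. -/

import Mathlib

open MeasureTheory ProbabilityTheory Filter

namespace SparseRegression

noncomputable section

/-- A prior for a single support coefficient: a probability law on the reals with finite second
moment, zero mean and variance `σ ^ 2`. -/
structure IsCoefficientPrior (ν : Measure ℝ) (σ : ℝ) : Prop where
  isProbabilityMeasure : IsProbabilityMeasure ν
  memLp : MemLp id 2 ν
  mean_eq_zero : ∫ x, x ∂ν = 0
  variance_eq : variance id ν = σ ^ 2

/-- The joint law of the `T × N` variable matrix `X`, the coefficients `b` and the noise `W`:
all entries are independent, `X t n` is Gaussian with mean `0` and variance `1 / T`, `b n` has law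
`ν`, and `W t` is Gaussian with mean `0` and variance `1 / snr`. -/
def law (ν : Measure ℝ) (N T : ℕ) (snr : ℝ) :
    Measure ((Fin T → Fin N → ℝ) × (Fin N → ℝ) × (Fin T → ℝ)) :=
  (Measure.pi fun _ : Fin T => Measure.pi fun _ : Fin N =>
      gaussianReal 0 (Real.toNNReal (1 / (T : ℝ)))).prod
    ((Measure.pi fun _ : Fin N => ν).prod
      (Measure.pi fun _ : Fin T => gaussianReal 0 (Real.toNNReal (1 / snr))))

/-- The sparse vector that agrees with `b` on `S` and vanishes off `S`. -/
def sparseVector {N : ℕ} (S : Finset (Fin N)) (b : Fin N → ℝ) : Fin N → ℝ :=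
  fun n => if n ∈ S then b n else 0

/-- The observation vector `Y = X β + W`, where `β` is the sparse vector with support `S` and
coefficients taken from `b`. -/
def observation {N T : ℕ} (S : Finset (Fin N))
    (ω : (Fin T → Fin N → ℝ) × (Fin N → ℝ) × (Fin T → ℝ)) : Fin T → ℝ :=
  fun t => ∑ n, ω.1 t n * sparseVector S ω.2.1 n + ω.2.2 t

/-- A decoder: a measurable map from the data `(X, Y)` to subsets of `{1, …, N}`. -/
structure Decoder (N T : ℕ) where
  estimate : (Fin T → Fin N → ℝ) × (Fin T → ℝ) → Finset (Fin N)
  measurable_fibers : ∀ S, MeasurableSet (estimate ⁻¹' {S})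

/-- The average error probability `Pr[Ŝ(X, Y) ≠ S]`, the true set `S` being uniformly distributed
over the `K`-element subsets of `{1, …, N}`, independently of everything else. -/
def errorProb (ν : Measure ℝ) {N T : ℕ} (K : ℕ) (snr : ℝ) (D : Decoder N T) : ℝ :=
  ∑ S ∈ Finset.powersetCard K (Finset.univ : Finset (Fin N)),
    (1 / (N.choose K : ℝ)) *
      (law ν N T snr).real {ω | D.estimate (ω.1, observation S ω) ≠ S}

/-- Scalings of sparsity, number of samples and signal-to-noise ratio with `N`: for all large `N`
one has `1 ≤ K < N / 2`, at least one sample and a positive signal-to-noise ratio. -/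
def IsScaling (K T : ℕ → ℕ) (snr : ℕ → ℝ) : Prop :=
  ∀ᶠ N : ℕ in atTop, 1 ≤ K N ∧ 2 * K N < N ∧ 1 ≤ T N ∧ 0 < snr N

/-- `cond` is necessary for recovery: whatever the decoders, the error probability stays bounded
away from zero along those `N` for which `cond N` fails. -/
def IsNecessary (ν : Measure ℝ) (K T : ℕ → ℕ) (snr : ℕ → ℝ) (cond : ℕ → Prop) : Prop :=
  ∃ δ : ℝ, 0 < δ ∧ ∀ D : (N : ℕ) → Decoder N (T N),
    ∀ᶠ N : ℕ in atTop, ¬ cond N → δ ≤ errorProb ν (K N) (snr N) (D N)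

/-- `cond` is sufficient for recovery: for some sequence of decoders the error probability tends to
zero along those `N` for which `cond N` holds. -/
def IsSufficient (ν : Measure ℝ) (K T : ℕ → ℕ) (snr : ℕ → ℝ) (cond : ℕ → Prop) : Prop :=
  ∃ D : (N : ℕ) → Decoder N (T N), ∀ ε : ℝ, 0 < ε →
    ∀ᶠ N : ℕ in atTop, cond N → errorProb ν (K N) (snr N) (D N) < ε

end

end SparseRegression

/-! The necessary conditions come from a change of measure. Let `P_S` be the law of the data with
support `S`, and `Q` a reference law that is the same for all `S` in a family of `M` supports. If
the log-likelihood ratio of `P_S` to `Q` is bounded above by a variable of mean at most `e`,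
Markov's inequality gives `P_S(Ŝ = S) ≤ exp τ * Q(Ŝ = S) + e / τ`. The events `Ŝ = S` are disjoint
under `Q`, so the average success probability is at most `exp τ / M + e / τ`
(`sum_law_estimate_eq_le`).

Two references are used. A smaller support `S₀` at the same noise level makes `e` comparable to the
missing signal energy times `snr` (`sum_law_estimate_eq_le_of_energy`). With all but one element
revealed, `snr * σ ^ 2` then competes with `log N`, which is the condition on `snr`. Pure noise with
the variance of the observations gives the capacity-like value `T / 2 * log (1 + K σ² snr / T) + T`
(`sum_law_estimate_eq_le_of_samples`), which competes with `log (N.choose K) ≥ K * log (N / K)`.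
This yields the condition on `T`, except when `σ ^ 2` is small: there the additive `T` is too large
and the energy bound with `S₀ = ∅` takes over.

For sufficiency the coefficients are rounded to a grid of mesh `Δ`, and the decoder looks for the
grid vector with `K`-element support nearest to the observation. A Chernoff bound over the noise and
then over `X` (`law_residual_le_le`) shows that a competitor missing `i` true elements wins with
probability at most a constant times `(1 + i snr β² / (32 T)) ^ (-T / 2)`. For large `T` and `snr`
this beats both the number of grid points and the roughly `N ^ i` competing supports
(`pow_mul_rpow_le`, `sum_inv_sq_pow_card_sdiff_le`). -/

namespace SparseRegression

open scoped ENNReal NNReal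

/-! ### Gaussian product measures: densities, moments, exponential integrals. -/

/-- A Gaussian law has an explicit exponential density with respect to any other one. -/
lemma gaussianReal_eq_withDensity (m m₀ : ℝ) {s v : ℝ≥0} (hs : s ≠ 0) (hv : v ≠ 0) :
    gaussianReal m s = (gaussianReal m₀ v).withDensity (fun y =>
      ENNReal.ofReal (Real.exp (Real.log (v / s) / 2 - (y - m) ^ 2 / (2 * s)
        + (y - m₀) ^ 2 / (2 * v)))) := by
  rw [gaussianReal_of_var_ne_zero _ hs, gaussianReal_of_var_ne_zero _ hv,
    ← withDensity_mul _ (by fun_prop) (by fun_prop)]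
  congr 1
  ext y
  have hs' : (0 : ℝ) < s := by positivity
  have hv' : (0 : ℝ) < v := by positivity
  simp only [gaussianPDF, Pi.mul_apply]
  rw [← ENNReal.ofReal_mul (gaussianPDFReal_nonneg _ _ _)]
  congr 1
  simp only [gaussianPDFReal]
  have h1 : Real.exp (Real.log (v / s) / 2) = √v / √s := by
    rw [← Real.sqrt_div hv'.le, Real.sqrt_eq_rpow, Real.rpow_def_of_pos (by positivity)]
    congr 1; ring
  have h2 : Real.exp (-(y - m) ^ 2 / (2 * s)) = Real.exp (-(y - m₀) ^ 2 / (2 * v))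
      * Real.exp (-((y - m) ^ 2 / (2 * s)) + (y - m₀) ^ 2 / (2 * v)) := by
    rw [← Real.exp_add]; congr 1; ring
  rw [sub_eq_add_neg (Real.log _ / 2), add_assoc, Real.exp_add (Real.log _ / 2), h1, h2,
    Real.sqrt_mul (by positivity) (s : ℝ), Real.sqrt_mul (by positivity) (v : ℝ)]
  have := Real.sqrt_pos.2 hv'
  have := Real.sqrt_pos.2 hs'
  have : 0 < √(2 * Real.pi) := by positivity
  field_simp

lemma lintegral_pi_prod {ι : Type*} [Fintype ι] {X : ι → Type*} [∀ i, MeasurableSpace (X i)]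
    (μ : (i : ι) → Measure (X i)) [∀ i, IsProbabilityMeasure (μ i)] (f : (i : ι) → X i → ℝ≥0∞)
    (hf : ∀ i, Measurable (f i)) :
    ∫⁻ x, ∏ i, f i (x i) ∂Measure.pi μ = ∏ i, ∫⁻ y, f i y ∂μ i := by
  rw [lintegral_prod_eq_prod_lintegral_of_indepFun (μ := Measure.pi μ) Finset.univ
    (fun i (x : (j : ι) → X j) => f i (x i)) (iIndepFun_pi fun i => (hf i).aemeasurable)
    fun i => (hf i).comp (measurable_pi_apply i)]
  refine Finset.prod_congr rfl fun i _ => ?_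
  rw [← (measurePreserving_eval μ i).lintegral_comp (hf i)]

lemma pi_withDensity {ι : Type*} [Fintype ι] {X : ι → Type*} [∀ i, MeasurableSpace (X i)]
    (μ : (i : ι) → Measure (X i)) [∀ i, IsProbabilityMeasure (μ i)] (f : (i : ι) → X i → ℝ≥0∞)
    (hf : ∀ i, Measurable (f i)) [∀ i, SigmaFinite ((μ i).withDensity (f i))] :
    Measure.pi (fun i => (μ i).withDensity (f i))
      = (Measure.pi μ).withDensity (fun x => ∏ i, f i (x i)) := by
  refine Measure.pi_eq fun s hs => ?_
  rw [withDensity_apply _ (MeasurableSet.univ_pi hs),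
    ← lintegral_indicator (MeasurableSet.univ_pi hs)]
  have : (Set.univ.pi s).indicator (fun x => ∏ i, f i (x i))
      = fun x => ∏ i, (s i).indicator (f i) (x i) := by
    ext x
    by_cases hx : x ∈ Set.univ.pi s
    · rw [Set.indicator_of_mem hx]
      exact Finset.prod_congr rfl fun i _ => (Set.indicator_of_mem (hx i trivial) _).symm
    · rw [Set.indicator_of_notMem hx]
      simp only [Set.mem_pi, Set.mem_univ, forall_const, not_forall] at hx
      obtain ⟨i, hi⟩ := hx
      exact (Finset.prod_eq_zero (Finset.mem_univ i) (Set.indicator_of_notMem hi _)).symm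
  rw [this, lintegral_pi_prod _ _ fun i => (hf i).indicator (hs i)]
  exact Finset.prod_congr rfl fun i _ => by
    rw [lintegral_indicator (hs i), withDensity_apply _ (hs i)]

lemma pi_gaussianReal_eq_withDensity {ι : Type*} [Fintype ι] (m m₀ : ι → ℝ) {s v : ℝ≥0}
    (hs : s ≠ 0) (hv : v ≠ 0) :
    Measure.pi (fun i => gaussianReal (m i) s)
      = (Measure.pi fun i => gaussianReal (m₀ i) v).withDensity (fun y => ENNReal.ofReal (Real.exp
        (∑ i, (Real.log (v / s) / 2 - (y i - m i) ^ 2 / (2 * s)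
          + (y i - m₀ i) ^ 2 / (2 * v))))) := by
  have h := fun i => gaussianReal_eq_withDensity (m i) (m₀ i) hs hv
  have : ∀ i, SigmaFinite ((gaussianReal (m₀ i) v).withDensity (fun y =>
      ENNReal.ofReal (Real.exp (Real.log (v / s) / 2 - (y - m i) ^ 2 / (2 * s)
        + (y - m₀ i) ^ 2 / (2 * v))))) := fun i => by rw [← h i]; infer_instance
  calc _ = Measure.pi (fun i => (gaussianReal (m₀ i) v).withDensity (fun y =>
      ENNReal.ofReal (Real.exp (Real.log (v / s) / 2 - (y - m i) ^ 2 / (2 * s)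
        + (y - m₀ i) ^ 2 / (2 * v))))) := by congr 1; ext1 i; exact h i
    _ = _ := by
      rw [pi_withDensity _ _ (fun i => by fun_prop)]
      congr 1
      ext y
      rw [Real.exp_sum, ENNReal.ofReal_prod_of_nonneg fun i _ => (Real.exp_pos _).le]

lemma pi_gaussianReal_map_add {ι : Type*} [Fintype ι] (m : ι → ℝ) (s : ℝ≥0) :
    (Measure.pi fun _ : ι => gaussianReal 0 s).map (fun w i => m i + w i)
      = Measure.pi (fun i => gaussianReal (m i) s) := by
  rw [Measure.pi_map_pi (μ := fun _ : ι => gaussianReal 0 s) (f := fun i w => m i + w)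
    (fun i => by fun_prop)]
  congr 1
  ext1 i
  rw [gaussianReal_map_const_add, zero_add]

/-- Linear combinations of independent centred Gaussian variables are Gaussian. -/
lemma pi_gaussianReal_map_sum {ι : Type*} [Fintype ι] (v : ℝ≥0) (c : ι → ℝ) :
    (Measure.pi fun _ : ι => gaussianReal 0 v).map (fun x => ∑ i, c i * x i)
      = gaussianReal 0 (v * Real.toNNReal (∑ i, c i ^ 2)) := by
  refine Measure.ext_of_charFun ?_
  ext t
  rw [charFun_gaussianReal, charFun_apply_real, integral_map
    (Finset.measurable_sum _ fun i _ => (measurable_pi_apply i).const_mul _).aemeasurable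
    (by fun_prop)]
  have h1 : ∀ x : ι → ℝ, Complex.exp (t * ((∑ i, c i * x i : ℝ) : ℂ) * Complex.I)
      = ∏ i, Complex.exp (((t * c i : ℝ) : ℂ) * (x i : ℂ) * Complex.I) := fun x => by
    rw [← Complex.exp_sum]
    congr 1
    push_cast
    rw [Finset.mul_sum, Finset.sum_mul]
    exact Finset.sum_congr rfl fun i _ => by ring
  simp_rw [h1]
  rw [integral_fintype_prod_eq_prod (f := fun i (x : ℝ) =>
    Complex.exp (((t * c i : ℝ) : ℂ) * (x : ℂ) * Complex.I))]
  have h2 := fun i => charFun_gaussianReal (μ := 0) (v := v) (t * c i)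
  simp_rw [charFun_apply_real] at h2
  simp_rw [h2]
  rw [← Complex.exp_sum]
  congr 1
  have : ((Real.toNNReal (∑ i, c i ^ 2) : ℝ≥0) : ℝ) = ∑ i, c i ^ 2 :=
    Real.coe_toNNReal _ (Finset.sum_nonneg fun i _ => sq_nonneg _)
  push_cast
  rw [this]
  push_cast
  simp only [mul_zero, zero_mul, zero_sub]
  rw [Finset.mul_sum, Finset.sum_mul, Finset.sum_div, ← Finset.sum_neg_distrib]
  exact Finset.sum_congr rfl fun i _ => by ring

lemma lintegral_sq_gaussianReal (v : ℝ≥0) :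
    ∫⁻ x, ENNReal.ofReal (x ^ 2) ∂gaussianReal 0 v = v := by
  have h := variance_fun_id_gaussianReal (μ := 0) (v := v)
  rw [variance_eq_integral (by fun_prop)] at h
  simp only [integral_id_gaussianReal, sub_zero] at h
  rw [← ofReal_integral_eq_lintegral_ofReal, h, ENNReal.ofReal_coe_nnreal]
  · exact (memLp_id_gaussianReal' 2 (by simp)).integrable_sq
  · exact ae_of_all _ fun x => sq_nonneg _

lemma lintegral_sum_sq_pi_gaussianReal {ι : Type*} [Fintype ι] (v : ℝ≥0) (c : ι → ℝ) :
    ∫⁻ x, ENNReal.ofReal ((∑ i, c i * x i) ^ 2) ∂(Measure.pi fun _ : ι => gaussianReal 0 v)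
      = ENNReal.ofReal (v * ∑ i, c i ^ 2) := by
  have := lintegral_map (μ := Measure.pi fun _ : ι => gaussianReal 0 v)
    (f := fun x : ℝ => ENNReal.ofReal (x ^ 2)) (g := fun x => ∑ i, c i * x i)
    (by fun_prop) (by fun_prop)
  rw [← this, pi_gaussianReal_map_sum, lintegral_sq_gaussianReal, ENNReal.ofReal_mul (by simp)]
  simp [ENNReal.ofReal]

lemma lintegral_exp_pi_gaussianReal {ι : Type*} [Fintype ι] (v : ℝ≥0) (c : ι → ℝ) :
    ∫⁻ x, ENNReal.ofReal (Real.exp (∑ i, c i * x i)) ∂(Measure.pi fun _ : ι => gaussianReal 0 v)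
      = ENNReal.ofReal (Real.exp (v * (∑ i, c i ^ 2) / 2)) := by
  have := lintegral_map (μ := Measure.pi fun _ : ι => gaussianReal 0 v)
    (f := fun x : ℝ => ENNReal.ofReal (Real.exp x)) (g := fun x => ∑ i, c i * x i)
    (by fun_prop) (by fun_prop)
  rw [← this, pi_gaussianReal_map_sum, ← ofReal_integral_eq_lintegral_ofReal]
  · have h := congrFun (mgf_id_gaussianReal (μ := 0) (v := v * Real.toNNReal (∑ i, c i ^ 2))) 1
    simp only [mgf, id, one_mul, zero_add, one_pow, mul_one] at h
    rw [h, NNReal.coe_mul, Real.coe_toNNReal _ (Finset.sum_nonneg fun i _ => sq_nonneg _)]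
  · simpa using integrable_exp_mul_gaussianReal (μ := 0)
      (v := v * Real.toNNReal (∑ i, c i ^ 2)) 1
  · exact ae_of_all _ fun x => (Real.exp_pos _).le

lemma lintegral_exp_neg_sq_gaussianReal (v : ℝ≥0) {s : ℝ} (hs : 0 ≤ s) :
    ∫⁻ x, ENNReal.ofReal (Real.exp (-(s * x ^ 2))) ∂gaussianReal 0 v
      = ENNReal.ofReal ((1 + 2 * s * v) ^ (-(1 / 2) : ℝ)) := by
  by_cases hv : v = 0
  · subst hv; simp
  have hv' : (0 : ℝ) < v := by positivity
  have hb : 0 < s + 1 / (2 * v) := by positivity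
  rw [gaussianReal_of_var_ne_zero _ hv, lintegral_withDensity_eq_lintegral_mul _ (by fun_prop)
    (by fun_prop)]
  have h1 : ∀ x : ℝ, (gaussianPDF 0 v * fun x => ENNReal.ofReal (Real.exp (-(s * x ^ 2)))) x
      = ENNReal.ofReal ((√(2 * Real.pi * v))⁻¹ * Real.exp (-(s + 1 / (2 * v)) * x ^ 2)) := fun x => by
    simp only [gaussianPDF, Pi.mul_apply]
    rw [← ENNReal.ofReal_mul (gaussianPDFReal_nonneg _ _ _), gaussianPDFReal, mul_assoc,
      ← Real.exp_add]
    congr 3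
    field_simp
    ring
  simp_rw [h1]
  rw [← ofReal_integral_eq_lintegral_ofReal ((integrable_exp_neg_mul_sq hb).const_mul _)
    (ae_of_all _ fun x => by positivity), integral_const_mul, integral_gaussian,
    ← Real.sqrt_inv, ← Real.sqrt_mul (by positivity), Real.rpow_neg (by positivity),
    ← Real.sqrt_eq_rpow, ← Real.sqrt_inv]
  congr 2
  have := Real.pi_pos
  have : 1 + 2 * s * v ≠ 0 := by positivity
  field_simp
  ring

/-- Change of measure between two shifted white Gaussian noises, on the event that the logarithm of
the likelihood ratio is at most `τ`. -/
lemma pi_gaussianReal_shift_le {ι : Type*} [Fintype ι] (m m₀ : ι → ℝ) {s v : ℝ≥0}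
    (hs : s ≠ 0) (hv : v ≠ 0) {B : Set (ι → ℝ)} (hB : MeasurableSet B) {z : (ι → ℝ) → ℝ}
    (hz : Measurable z) (τ : ℝ)
    (h : ∀ w, ∑ i, (Real.log (v / s) / 2 - w i ^ 2 / (2 * s)
      + (m i + w i - m₀ i) ^ 2 / (2 * v)) ≤ z w) :
    (Measure.pi fun _ : ι => gaussianReal 0 s) {w | (fun i => m i + w i) ∈ B ∧ z w ≤ τ}
      ≤ ENNReal.ofReal (Real.exp τ)
        * (Measure.pi fun _ : ι => gaussianReal 0 v) {w | (fun i => m₀ i + w i) ∈ B} := by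
  have hm : ∀ m : ι → ℝ, Measurable (fun (w : ι → ℝ) i => m i + w i) := fun m => by fun_prop
  have hm' : Measurable (fun (y : ι → ℝ) i => y i - m i) := by fun_prop
  have hE : MeasurableSet (B ∩ {y | z (fun i => y i - m i) ≤ τ}) :=
    hB.inter (measurableSet_le (hz.comp hm') measurable_const)
  have h1 : {w : ι → ℝ | (fun i => m i + w i) ∈ B ∧ z w ≤ τ}
      = (fun (w : ι → ℝ) i => m i + w i) ⁻¹' (B ∩ {y | z (fun i => y i - m i) ≤ τ}) := by
    ext w; simp
  have h2 : {w : ι → ℝ | (fun i => m₀ i + w i) ∈ B} = (fun (w : ι → ℝ) i => m₀ i + w i) ⁻¹' B := rfl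
  rw [h1, h2, ← Measure.map_apply (hm m) hE, ← Measure.map_apply (hm m₀) hB,
    pi_gaussianReal_map_add, pi_gaussianReal_map_add,
    pi_gaussianReal_eq_withDensity m m₀ hs hv, withDensity_apply _ hE]
  calc _ ≤ ∫⁻ _ in B ∩ {y | z (fun i => y i - m i) ≤ τ}, ENNReal.ofReal (Real.exp τ)
        ∂(Measure.pi fun i => gaussianReal (m₀ i) v) := by
        refine setLIntegral_mono measurable_const fun y hy => ?_
        refine ENNReal.ofReal_le_ofReal (Real.exp_le_exp.2 (le_trans ?_ hy.2))
        refine le_trans (le_of_eq ?_) (h _)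
        exact Finset.sum_congr rfl fun i _ => by congr 3; ring
    _ ≤ _ := by
        rw [setLIntegral_const]
        gcongr
        exact Set.inter_subset_left

/-! ### Change of measure for the joint law. -/

variable {N T : ℕ}

instance isProbabilityMeasure_law (ν : Measure ℝ) [IsProbabilityMeasure ν] (snr : ℝ) :
    IsProbabilityMeasure (law ν N T snr) := by
  unfold law; infer_instance

lemma lintegral_law (ν : Measure ℝ) [IsProbabilityMeasure ν] (snr : ℝ)
    {f : (Fin T → Fin N → ℝ) × (Fin N → ℝ) × (Fin T → ℝ) → ℝ≥0∞} (hf : Measurable f) :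
    ∫⁻ ω, f ω ∂law ν N T snr
      = ∫⁻ b, ∫⁻ x, ∫⁻ w, f (x, b, w)
        ∂(Measure.pi fun _ : Fin T => gaussianReal 0 (Real.toNNReal (1 / snr)))
        ∂(Measure.pi fun _ : Fin T => Measure.pi fun _ : Fin N =>
          gaussianReal 0 (Real.toNNReal (1 / (T : ℝ))))
        ∂(Measure.pi fun _ : Fin N => ν) := by
  unfold law
  rw [lintegral_prod _ hf.aemeasurable]
  have : ∀ x, ∫⁻ y, f (x, y) ∂((Measure.pi fun _ : Fin N => ν).prod
      (Measure.pi fun _ : Fin T => gaussianReal 0 (Real.toNNReal (1 / snr))))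
      = ∫⁻ b, ∫⁻ w, f (x, b, w)
        ∂(Measure.pi fun _ : Fin T => gaussianReal 0 (Real.toNNReal (1 / snr)))
        ∂(Measure.pi fun _ : Fin N => ν) := fun x =>
    lintegral_prod _ (hf.comp measurable_prodMk_left).aemeasurable
  simp_rw [this]
  rw [lintegral_lintegral_swap]
  refine Measurable.aemeasurable ?_
  have : Measurable fun p : ((Fin T → Fin N → ℝ) × (Fin N → ℝ)) × (Fin T → ℝ) =>
      f (p.1.1, p.1.2, p.2) := hf.comp (by fun_prop)
  exact this.lintegral_prod_right'

lemma measurable_sparseVector (S : Finset (Fin N)) (n : Fin N) :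
    Measurable fun b : Fin N → ℝ => sparseVector S b n := by
  unfold sparseVector
  split_ifs <;> fun_prop

lemma measurable_observation (S : Finset (Fin N)) :
    Measurable (observation S : (Fin T → Fin N → ℝ) × (Fin N → ℝ) × (Fin T → ℝ) → Fin T → ℝ) := by
  unfold observation
  refine measurable_pi_lambda _ fun t => Measurable.add (Finset.measurable_sum _ fun n _ => ?_)
    (by fun_prop)
  exact Measurable.mul (by fun_prop) ((measurable_sparseVector S n).comp (by fun_prop))

lemma Decoder.measurableSet_estimate_eq (D : Decoder N T) (S S' : Finset (Fin N)) :
    MeasurableSet {ω : (Fin T → Fin N → ℝ) × (Fin N → ℝ) × (Fin T → ℝ) |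
      D.estimate (ω.1, observation S ω) = S'} :=
  (measurable_fst.prodMk (measurable_observation S)) (D.measurable_fibers S')

/-- The difference of the signals with supports `S` and `S₀`. -/
noncomputable def signalGap (S S₀ : Finset (Fin N))
    (ω : (Fin T → Fin N → ℝ) × (Fin N → ℝ) × (Fin T → ℝ)) (t : Fin T) : ℝ :=
  ∑ n, ω.1 t n * (sparseVector S ω.2.1 n - sparseVector S₀ ω.2.1 n)

/-- The logarithm of the likelihood ratio of the observation with support `S` at the
signal-to-noise ratio `snr` to the one with support `S₀` at the ratio `snr₀`. -/
noncomputable def logLikelihoodRatio (snr snr₀ : ℝ) (S S₀ : Finset (Fin N))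
    (ω : (Fin T → Fin N → ℝ) × (Fin N → ℝ) × (Fin T → ℝ)) : ℝ :=
  ∑ t, (Real.log (snr / snr₀) / 2 - snr * ω.2.2 t ^ 2 / 2
    + snr₀ * (signalGap S S₀ ω t + ω.2.2 t) ^ 2 / 2)

lemma measurable_signalGap (S S₀ : Finset (Fin N)) (t : Fin T) :
    Measurable fun ω : (Fin T → Fin N → ℝ) × (Fin N → ℝ) × (Fin T → ℝ) => signalGap S S₀ ω t := by
  unfold signalGap
  refine Finset.measurable_sum _ fun n _ => Measurable.mul (by fun_prop) (Measurable.sub ?_ ?_)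
  · exact (measurable_sparseVector S n).comp (by fun_prop)
  · exact (measurable_sparseVector S₀ n).comp (by fun_prop)

lemma law_prod_apply (ν : Measure ℝ) [IsProbabilityMeasure ν] (snr : ℝ)
    {E : Set ((Fin T → Fin N → ℝ) × (Fin N → ℝ) × (Fin T → ℝ))} (hE : MeasurableSet E) :
    law ν N T snr E = ∫⁻ b, ∫⁻ x,
        (Measure.pi fun _ : Fin T => gaussianReal 0 (Real.toNNReal (1 / snr))) {w | (x, b, w) ∈ E}
        ∂(Measure.pi fun _ : Fin T => Measure.pi fun _ : Fin N =>
          gaussianReal 0 (Real.toNNReal (1 / (T : ℝ))))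
        ∂(Measure.pi fun _ : Fin N => ν) := by
  rw [← lintegral_indicator_one hE, lintegral_law _ _ (measurable_one.indicator hE)]
  congr 1; ext b; congr 1; ext x
  have : MeasurableSet {w | (x, b, w) ∈ E} :=
    (by fun_prop : Measurable fun w : Fin T → ℝ => (x, b, w)) hE
  rw [← lintegral_indicator_one this]
  rfl

/-- Both laws share `X` and the coefficients `b`. Conditionally on these the observations are two
shifted white noises, so the Gaussian change of measure applies fibrewise. The majorant `z` is left
free so that its mean can be computed exactly. -/
lemma law_estimate_eq_le (ν : Measure ℝ) [IsProbabilityMeasure ν] {snr snr₀ : ℝ} (hs : 0 < snr)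
    (hs₀ : 0 < snr₀) (D : Decoder N T) (S S₀ : Finset (Fin N))
    {z : (Fin T → Fin N → ℝ) × (Fin N → ℝ) × (Fin T → ℝ) → ℝ} (hz : Measurable z) (τ : ℝ)
    (h : ∀ ω, logLikelihoodRatio snr snr₀ S S₀ ω ≤ z ω) :
    law ν N T snr {ω | D.estimate (ω.1, observation S ω) = S ∧ z ω ≤ τ}
      ≤ ENNReal.ofReal (Real.exp τ)
        * law ν N T snr₀ {ω | D.estimate (ω.1, observation S₀ ω) = S} := by
  have hE : MeasurableSet {ω | D.estimate (ω.1, observation S ω) = S ∧ z ω ≤ τ} :=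
    (D.measurableSet_estimate_eq S S).inter (measurableSet_le hz measurable_const)
  rw [law_prod_apply _ _ hE, law_prod_apply _ _ (D.measurableSet_estimate_eq S₀ S),
    ← lintegral_const_mul' _ _ ENNReal.ofReal_ne_top]
  refine lintegral_mono fun b => ?_
  rw [← lintegral_const_mul' _ _ ENNReal.ofReal_ne_top]
  refine lintegral_mono fun x => ?_
  refine pi_gaussianReal_shift_le (fun t => ∑ n, x t n * sparseVector S b n)
    (fun t => ∑ n, x t n * sparseVector S₀ b n) (by simpa using hs) (by simpa using hs₀)
    (B := {y | D.estimate (x, y) = S}) (z := fun w => z (x, b, w)) ?_ (hz.comp (by fun_prop)) τ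
    fun w => ?_
  · exact (by fun_prop : Measurable fun y : Fin T → ℝ => (x, y)) (D.measurable_fibers S)
  · refine le_trans (le_of_eq ?_) (h (x, b, w))
    refine Finset.sum_congr rfl fun t _ => ?_
    rw [Real.coe_toNNReal _ (by positivity), Real.coe_toNNReal _ (by positivity)]
    simp only [signalGap, mul_sub, Finset.sum_sub_distrib]
    have : 1 / snr₀ / (1 / snr) = snr / snr₀ := by field_simp
    rw [this]
    field_simp
    ring

/-- A bound on the total success probability over a family of supports, through the means of upper
bounds on the log-likelihood ratios. -/
lemma sum_law_estimate_eq_le (ν : Measure ℝ) [IsProbabilityMeasure ν] {snr snr₀ : ℝ} (hs : 0 < snr)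
    (hs₀ : 0 < snr₀) (D : Decoder N T) (S₀ : Finset (Fin N)) (F : Finset (Finset (Fin N)))
    {z : Finset (Fin N) → (Fin T → Fin N → ℝ) × (Fin N → ℝ) × (Fin T → ℝ) → ℝ}
    (hz : ∀ S, Measurable (z S)) {τ e : ℝ} (hτ : 0 < τ) (he : 0 ≤ e)
    (h : ∀ S ∈ F, ∀ ω, logLikelihoodRatio snr snr₀ S S₀ ω ≤ z S ω)
    (hE : ∀ S ∈ F, ∫⁻ ω, ENNReal.ofReal (z S ω) ∂law ν N T snr ≤ ENNReal.ofReal e) :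
    ∑ S ∈ F, (law ν N T snr).real {ω | D.estimate (ω.1, observation S ω) = S}
      ≤ Real.exp τ + F.card * (e / τ) := by
  have h1 : ∀ S ∈ F, (law ν N T snr).real {ω | D.estimate (ω.1, observation S ω) = S}
      ≤ Real.exp τ * (law ν N T snr₀).real {ω | D.estimate (ω.1, observation S₀ ω) = S}
        + e / τ := fun S hS => by
    have h2 := law_estimate_eq_le ν hs hs₀ D S S₀ (hz S) τ (h S hS)
    have h3 : law ν N T snr {ω | τ ≤ z S ω} ≤ ENNReal.ofReal (e / τ) := by
      rw [ENNReal.ofReal_div_of_pos hτ]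
      refine le_trans ?_ (ENNReal.div_le_div_right (hE S hS) _)
      refine le_trans (measure_mono fun ω hω => ?_) (meas_ge_le_lintegral_div
        (hz S).ennreal_ofReal.aemeasurable (by simpa using hτ) ENNReal.ofReal_ne_top)
      exact ENNReal.ofReal_le_ofReal hω
    have h4 : (law ν N T snr).real {ω | D.estimate (ω.1, observation S ω) = S ∧ z S ω ≤ τ}
        ≤ Real.exp τ * (law ν N T snr₀).real {ω | D.estimate (ω.1, observation S₀ ω) = S} := by
      have := ENNReal.toReal_mono (by finiteness) h2
      rwa [ENNReal.toReal_mul, ENNReal.toReal_ofReal (Real.exp_pos _).le] at this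
    have h5 : (law ν N T snr).real {ω | τ ≤ z S ω} ≤ e / τ :=
      ENNReal.toReal_le_of_le_ofReal (by positivity) h3
    refine le_trans ?_ (add_le_add h4 h5)
    refine le_trans (measureReal_mono fun ω hω => ?_) (measureReal_union_le _ _)
    rcases le_total (z S ω) τ with h | h
    exacts [Or.inl ⟨hω, h⟩, Or.inr h]
  refine le_trans (Finset.sum_le_sum h1) ?_
  rw [Finset.sum_add_distrib, ← Finset.mul_sum, Finset.sum_const, nsmul_eq_mul]
  gcongr
  -- Under the single reference law the events of decoding to different `S` are disjoint, so their
  -- probabilities add up to at most one.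
  refine mul_le_of_le_one_right (Real.exp_pos _).le ?_
  rw [← measureReal_biUnion_finset (fun S _ S' _ hSS' => Set.disjoint_left.2 fun ω h1 h2 =>
    hSS' (h1.symm.trans h2)) fun S _ => D.measurableSet_estimate_eq S₀ S]
  exact measureReal_le_one

/-! ### Second moments, and the two bounds on the total success probability. -/

lemma IsCoefficientPrior.lintegral_sq {ν : Measure ℝ} {σ : ℝ} (h : IsCoefficientPrior ν σ) :
    ∫⁻ x, ENNReal.ofReal (x ^ 2) ∂ν = ENNReal.ofReal (σ ^ 2) := by
  have := h.isProbabilityMeasure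
  have h1 := h.variance_eq
  rw [variance_eq_integral (by fun_prop)] at h1
  simp only [id, h.mean_eq_zero, sub_zero] at h1
  have h2 : Integrable (fun x : ℝ => x ^ 2) ν := h.memLp.integrable_sq
  rw [← ofReal_integral_eq_lintegral_ofReal h2 (ae_of_all _ fun x => sq_nonneg _), h1]

/-- The variance `1 / T` of the entries makes `X` preserve energy on average. -/
lemma lintegral_sum_sq_signal (hT : 1 ≤ T) (d : Fin N → ℝ) :
    ∫⁻ x, ENNReal.ofReal (∑ t, (∑ n, x t n * d n) ^ 2)
        ∂(Measure.pi fun _ : Fin T => Measure.pi fun _ : Fin N =>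
          gaussianReal 0 (Real.toNNReal (1 / (T : ℝ))))
      = ENNReal.ofReal (∑ n, d n ^ 2) := by
  simp_rw [ENNReal.ofReal_sum_of_nonneg fun i (_ : i ∈ Finset.univ) => sq_nonneg _]
  rw [lintegral_finsetSum _ fun t _ => by fun_prop]
  have h1 : ∀ t : Fin T, ∫⁻ x, ENNReal.ofReal ((∑ n, x t n * d n) ^ 2)
        ∂(Measure.pi fun _ : Fin T => Measure.pi fun _ : Fin N =>
          gaussianReal 0 (Real.toNNReal (1 / (T : ℝ))))
      = ENNReal.ofReal (1 / T * ∑ n, d n ^ 2) := fun t => by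
    rw [(measurePreserving_eval (fun _ : Fin T => Measure.pi fun _ : Fin N =>
          gaussianReal 0 (Real.toNNReal (1 / (T : ℝ)))) t).lintegral_comp
        (f := fun r : Fin N → ℝ => ENNReal.ofReal ((∑ n, r n * d n) ^ 2)) (by fun_prop)]
    simp_rw [mul_comm _ (d _)]
    rw [lintegral_sum_sq_pi_gaussianReal, Real.coe_toNNReal _ (by positivity)]
  simp_rw [h1]
  rw [Finset.sum_const, Finset.card_univ, Fintype.card_fin, ← ENNReal.ofReal_nsmul]
  rw [← ENNReal.ofReal_sum_of_nonneg fun i (_ : i ∈ Finset.univ) => sq_nonneg _]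
  congr 1
  have : (T : ℝ) ≠ 0 := by positivity
  rw [nsmul_eq_mul]
  field_simp

lemma lintegral_sum_sq_coefficients {ν : Measure ℝ} {σ : ℝ} (hν : IsCoefficientPrior ν σ)
    (S : Finset (Fin N)) :
    ∫⁻ b, ENNReal.ofReal (∑ n ∈ S, b n ^ 2) ∂(Measure.pi fun _ : Fin N => ν)
      = ENNReal.ofReal (S.card * σ ^ 2) := by
  have := hν.isProbabilityMeasure
  simp_rw [ENNReal.ofReal_sum_of_nonneg fun i (_ : i ∈ S) => sq_nonneg _]
  rw [lintegral_finsetSum _ fun t _ => by fun_prop]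
  have h2 : ∀ n : Fin N, ∫⁻ b, ENNReal.ofReal (b n ^ 2) ∂(Measure.pi fun _ : Fin N => ν)
      = ENNReal.ofReal (σ ^ 2) := fun n => by
    rw [(measurePreserving_eval (fun _ : Fin N => ν) n).lintegral_comp
        (f := fun r : ℝ => ENNReal.ofReal (r ^ 2)) (by fun_prop), hν.lintegral_sq]
  simp_rw [h2]
  rw [Finset.sum_const, ← ENNReal.ofReal_nsmul, nsmul_eq_mul]

lemma lintegral_signalGap {ν : Measure ℝ} {σ : ℝ} (hν : IsCoefficientPrior ν σ) (hT : 1 ≤ T)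
    (snr : ℝ) {S S₀ : Finset (Fin N)} (hS : S₀ ⊆ S) :
    ∫⁻ ω, ENNReal.ofReal (∑ t, signalGap S S₀ ω t ^ 2) ∂law ν N T snr
      = ENNReal.ofReal ((S \ S₀).card * σ ^ 2) := by
  have := hν.isProbabilityMeasure
  have hm := fun t => measurable_signalGap (T := T) S S₀ t
  rw [lintegral_law _ _ (by fun_prop)]
  simp only [signalGap, lintegral_const, measure_univ, mul_one]
  simp_rw [lintegral_sum_sq_signal hT]
  have h1 : ∀ b : Fin N → ℝ, ∑ n, (sparseVector S b n - sparseVector S₀ b n) ^ 2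
      = ∑ n ∈ S \ S₀, b n ^ 2 := fun b => by
    rw [← Finset.sum_subset (Finset.subset_univ (S \ S₀))]
    · refine Finset.sum_congr rfl fun n hn => ?_
      rw [Finset.mem_sdiff] at hn
      simp [sparseVector, hn.1, hn.2]
    · intro n _ hn
      rw [Finset.mem_sdiff, not_and_not_right] at hn
      by_cases h : n ∈ S
      · simp [sparseVector, h, hn h]
      · simp [sparseVector, h, show n ∉ S₀ from fun h' => h (hS h')]
  simp_rw [h1]
  exact lintegral_sum_sq_coefficients hν _

lemma lintegral_noise (ν : Measure ℝ) [IsProbabilityMeasure ν] (snr : ℝ) :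
    ∫⁻ ω, ENNReal.ofReal (∑ t, ω.2.2 t ^ 2) ∂law ν N T snr = ENNReal.ofReal (T / snr) := by
  rw [lintegral_law _ _ (by fun_prop)]
  simp only [lintegral_const, measure_univ, mul_one]
  simp_rw [ENNReal.ofReal_sum_of_nonneg fun i (_ : i ∈ Finset.univ) => sq_nonneg _]
  rw [lintegral_finsetSum _ fun t _ => by fun_prop]
  have h2 : ∀ t : Fin T, ∫⁻ w, ENNReal.ofReal (w t ^ 2)
      ∂(Measure.pi fun _ : Fin T => gaussianReal 0 (Real.toNNReal (1 / snr)))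
      = ENNReal.ofReal (1 / snr) := fun t => by
    rw [(measurePreserving_eval (fun _ : Fin T => gaussianReal 0 (Real.toNNReal (1 / snr)))
      t).lintegral_comp (f := fun r : ℝ => ENNReal.ofReal (r ^ 2)) (by fun_prop),
      lintegral_sq_gaussianReal]
    rfl
  simp_rw [h2]
  rw [Finset.sum_const, ← ENNReal.ofReal_nsmul, nsmul_eq_mul, Finset.card_univ, Fintype.card_fin]
  congr 1
  ring

/-- Given `X` and `b` the inner product is centred Gaussian with variance `1 / snr` times the energy
of the gap. -/
lemma lintegral_inner_signalGap_noise {ν : Measure ℝ} {σ : ℝ} (hν : IsCoefficientPrior ν σ)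
    (hT : 1 ≤ T) {snr : ℝ} (hs : 0 < snr) {S S₀ : Finset (Fin N)} (hS : S₀ ⊆ S) :
    ∫⁻ ω, ENNReal.ofReal ((∑ t, signalGap S S₀ ω t * ω.2.2 t) ^ 2) ∂law ν N T snr
      = ENNReal.ofReal ((S \ S₀).card * σ ^ 2 / snr) := by
  have := hν.isProbabilityMeasure
  have hm := fun t => measurable_signalGap (T := T) S S₀ t
  rw [div_eq_inv_mul, ENNReal.ofReal_mul (by positivity), ← lintegral_signalGap hν hT snr hS,
    ← lintegral_const_mul _ (by fun_prop), lintegral_law _ _ (by fun_prop),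
    lintegral_law _ _ (by fun_prop)]
  congr 1; ext b; congr 1; ext x
  have h1 := lintegral_sum_sq_pi_gaussianReal (Real.toNNReal (1 / snr))
    (fun t => signalGap S S₀ (x, b, fun _ : Fin T => 0) t)
  have h2 : ∀ w, signalGap S S₀ (x, b, w) = signalGap S S₀ (x, b, fun _ : Fin T => 0) :=
    fun w => rfl
  simp_rw [h2]
  rw [h1, lintegral_const, measure_univ, mul_one, ← ENNReal.ofReal_mul (by positivity),
    Real.coe_toNNReal _ (by positivity), one_div]

/-- At equal noise levels the log-likelihood ratio is `snr / 2 * ‖g‖² + snr * ⟨g, w⟩` for the gap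
`g`. The cross term has no sign, and `s ≤ (1 + s ^ 2) / 2` replaces it by a nonnegative variable of
known mean. -/
lemma sum_law_estimate_eq_le_of_energy {ν : Measure ℝ} {σ : ℝ} (hν : IsCoefficientPrior ν σ)
    (hT : 1 ≤ T) {snr : ℝ} (hs : 0 < snr) (D : Decoder N T) (S₀ : Finset (Fin N))
    (F : Finset (Finset (Fin N))) {M : ℕ} (hF : ∀ S ∈ F, S₀ ⊆ S ∧ (S \ S₀).card = M) {τ : ℝ}
    (hτ : 0 < τ) :
    ∑ S ∈ F, (law ν N T snr).real {ω | D.estimate (ω.1, observation S ω) = S}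
      ≤ Real.exp τ + F.card * ((1 / 2 + snr * (M * σ ^ 2)) / τ) := by
  have := hν.isProbabilityMeasure
  have hm := fun S t => measurable_signalGap (T := T) S S₀ t
  refine sum_law_estimate_eq_le ν hs hs D S₀ F
    (z := fun S ω => 1 / 2 + snr / 2 * ∑ t, signalGap S S₀ ω t ^ 2
      + snr ^ 2 / 2 * (∑ t, signalGap S S₀ ω t * ω.2.2 t) ^ 2) (fun S => by fun_prop) hτ
      (by positivity) (fun S hS ω => ?_) fun S hS => ?_
  · have h1 : logLikelihoodRatio snr snr S S₀ ω = snr / 2 * ∑ t, signalGap S S₀ ω t ^ 2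
        + snr * ∑ t, signalGap S S₀ ω t * ω.2.2 t := by
      simp only [logLikelihoodRatio, div_self hs.ne', Real.log_one, Finset.mul_sum,
        ← Finset.sum_add_distrib]
      exact Finset.sum_congr rfl fun t _ => by ring
    rw [h1]
    nlinarith [sq_nonneg (1 - snr * ∑ t, signalGap S S₀ ω t * ω.2.2 t)]
  · obtain ⟨h1, h2⟩ := hF S hS
    have h3 : ∀ ω : (Fin T → Fin N → ℝ) × (Fin N → ℝ) × (Fin T → ℝ),
        0 ≤ ∑ t, signalGap S S₀ ω t ^ 2 := fun ω => Finset.sum_nonneg fun t _ => sq_nonneg _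
    simp_rw [fun ω : (Fin T → Fin N → ℝ) × (Fin N → ℝ) × (Fin T → ℝ) => ENNReal.ofReal_add
      (add_nonneg one_half_pos.le (mul_nonneg (half_pos hs).le (h3 ω)))
      (mul_nonneg (half_pos (pow_pos hs 2)).le (sq_nonneg (∑ t, signalGap S S₀ ω t * ω.2.2 t))),
      fun ω : (Fin T → Fin N → ℝ) × (Fin N → ℝ) × (Fin T → ℝ) => ENNReal.ofReal_add
      one_half_pos.le (mul_nonneg (half_pos hs).le (h3 ω)), ENNReal.ofReal_mul (half_pos hs).le,
      ENNReal.ofReal_mul (half_pos (pow_pos hs 2)).le]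
    rw [lintegral_add_left (by fun_prop), lintegral_add_left (by fun_prop),
      lintegral_const_mul _ (by fun_prop), lintegral_const_mul _ (by fun_prop),
      lintegral_signalGap hν hT snr h1, lintegral_inner_signalGap_noise hν hT hs h1, h2,
      lintegral_const, measure_univ, mul_one, ← ENNReal.ofReal_mul (by positivity),
      ← ENNReal.ofReal_mul (by positivity), ← ENNReal.ofReal_add (by positivity) (by positivity),
      ← ENNReal.ofReal_add (by positivity) (by positivity)]
    refine ENNReal.ofReal_le_ofReal (le_of_eq ?_)
    field_simp
    ring

lemma sum_law_estimate_eq_le_of_samples {ν : Measure ℝ} {σ : ℝ} (hν : IsCoefficientPrior ν σ)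
    (hT : 1 ≤ T) {snr : ℝ} (hs : 0 < snr) (D : Decoder N T)
    (F : Finset (Finset (Fin N))) {K : ℕ} (hF : ∀ S ∈ F, S.card = K) {τ : ℝ}
    (hτ : 0 < τ) :
    ∑ S ∈ F, (law ν N T snr).real {ω | D.estimate (ω.1, observation S ω) = S}
      ≤ Real.exp τ
        + F.card * ((T / 2 * Real.log (1 + K * σ ^ 2 * snr / T) + T) / τ) := by
  have := hν.isProbabilityMeasure
  have hm := fun S t => measurable_signalGap (T := T) S (∅ : Finset (Fin N)) t
  have hT' : (0 : ℝ) < T := by positivity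
  -- The reference noise has the variance of one observation, signal included, so the quadratic
  -- terms of the majorant have total mean exactly `T`.
  set snr₀ : ℝ := 1 / (K * σ ^ 2 / T + 1 / snr) with hsnr₀
  have hs₀ : 0 < snr₀ := by positivity
  have hr : snr / snr₀ = 1 + K * σ ^ 2 * snr / T := by
    rw [hsnr₀]; field_simp; ring
  have hlog : 0 ≤ Real.log (1 + K * σ ^ 2 * snr / T) := Real.log_nonneg (by
    have : 0 ≤ K * σ ^ 2 * snr / T := by positivity
    linarith)
  refine sum_law_estimate_eq_le ν hs hs₀ D ∅ F
    (z := fun S ω => T / 2 * Real.log (1 + K * σ ^ 2 * snr / T)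
      + snr₀ * (∑ t, signalGap S ∅ ω t ^ 2) + snr₀ * ∑ t, ω.2.2 t ^ 2) (fun S => by fun_prop) hτ
      (by positivity) (fun S hS ω => ?_) fun S hS => ?_
  · have h1 : T / 2 * Real.log (1 + K * σ ^ 2 * snr / T)
      + snr₀ * (∑ t, signalGap S ∅ ω t ^ 2) + snr₀ * ∑ t, ω.2.2 t ^ 2
      = ∑ t, (Real.log (snr / snr₀) / 2 + snr₀ * signalGap S ∅ ω t ^ 2
        + snr₀ * ω.2.2 t ^ 2) := by
      rw [Finset.sum_add_distrib, Finset.sum_add_distrib, Finset.mul_sum, Finset.mul_sum,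
        Finset.sum_const, Finset.card_univ, Fintype.card_fin, nsmul_eq_mul, hr]
      ring
    rw [h1]
    -- Termwise: the negative noise term is dropped and `(g + w) ^ 2 ≤ 2 * g ^ 2 + 2 * w ^ 2`.
    refine Finset.sum_le_sum fun t _ => ?_
    nlinarith [mul_nonneg hs₀.le (sq_nonneg (signalGap S ∅ ω t - ω.2.2 t)),
      mul_nonneg hs.le (sq_nonneg (ω.2.2 t))]
  · have h3 : ∀ ω : (Fin T → Fin N → ℝ) × (Fin N → ℝ) × (Fin T → ℝ),
        0 ≤ ∑ t, signalGap S ∅ ω t ^ 2 := fun ω => Finset.sum_nonneg fun t _ => sq_nonneg _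
    have h4 : ∀ ω : (Fin T → Fin N → ℝ) × (Fin N → ℝ) × (Fin T → ℝ),
        0 ≤ ∑ t, ω.2.2 t ^ 2 := fun ω => Finset.sum_nonneg fun t _ => sq_nonneg _
    have h5 : 0 ≤ T / 2 * Real.log (1 + K * σ ^ 2 * snr / T) := by positivity
    simp_rw [fun ω => ENNReal.ofReal_add (add_nonneg h5 (mul_nonneg hs₀.le (h3 ω)))
      (mul_nonneg hs₀.le (h4 ω)), fun ω => ENNReal.ofReal_add h5 (mul_nonneg hs₀.le (h3 ω)),
      ENNReal.ofReal_mul hs₀.le]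
    rw [lintegral_add_left (by fun_prop), lintegral_add_left (by fun_prop),
      lintegral_const_mul _ (by fun_prop), lintegral_const_mul _ (by fun_prop),
      lintegral_signalGap hν hT snr (Finset.empty_subset S), lintegral_noise, Finset.sdiff_empty,
      hF S hS, lintegral_const, measure_univ, mul_one, ← ENNReal.ofReal_mul (by positivity),
      ← ENNReal.ofReal_mul (by positivity), ← ENNReal.ofReal_add (by positivity) (by positivity),
      ← ENNReal.ofReal_add (by positivity) (by positivity)]
    refine ENNReal.ofReal_le_ofReal (le_of_eq ?_)
    rw [hsnr₀]
    field_simp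
    ring

/-! ### From success probabilities to lower bounds on the error. -/

lemma errorProb_eq (ν : Measure ℝ) [IsProbabilityMeasure ν] {K : ℕ} (hK : K ≤ N) (snr : ℝ)
    (D : Decoder N T) :
    errorProb ν K snr D = 1 - (∑ S ∈ Finset.powersetCard K (Finset.univ : Finset (Fin N)),
      (law ν N T snr).real {ω | D.estimate (ω.1, observation S ω) = S}) / N.choose K := by
  have h1 : ∀ S : Finset (Fin N), (law ν N T snr).real {ω | D.estimate (ω.1, observation S ω) ≠ S}
      = 1 - (law ν N T snr).real {ω | D.estimate (ω.1, observation S ω) = S} := fun S =>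
    probReal_compl_eq_one_sub (D.measurableSet_estimate_eq S S)
  have h2 : (N.choose K : ℝ) ≠ 0 := by
    have := Nat.choose_pos hK
    positivity
  simp_rw [errorProb, h1, ← Finset.mul_sum, Finset.sum_sub_distrib, Finset.sum_const,
    Finset.card_powersetCard, Finset.card_univ, Fintype.card_fin, nsmul_eq_mul]
  field_simp

/-- Double counting: each `S` of size `K + 1` has `K + 1` subsets of size `K`. -/
lemma sum_powersetCard_supersets (f : Finset (Fin N) → ℝ) (K : ℕ) :
    ∑ S₀ ∈ Finset.powersetCard K (Finset.univ : Finset (Fin N)),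
      ∑ S ∈ Finset.powersetCard (K + 1) (Finset.univ : Finset (Fin N)) with S₀ ⊆ S, f S
      = (K + 1) * ∑ S ∈ Finset.powersetCard (K + 1) (Finset.univ : Finset (Fin N)), f S := by
  simp_rw [Finset.sum_filter]
  rw [Finset.sum_comm, Finset.mul_sum]
  refine Finset.sum_congr rfl fun S hS => ?_
  rw [← Finset.sum_filter, Finset.sum_const, nsmul_eq_mul]
  have : (Finset.powersetCard K (Finset.univ : Finset (Fin N))).filter (· ⊆ S)
      = Finset.powersetCard K S := by
    ext S₀; simp [Finset.mem_powersetCard, and_comm]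
  rw [this, Finset.card_powersetCard, (Finset.mem_powersetCard.1 hS).2, Nat.choose_succ_self_right]
  push_cast
  ring

/-- Even if all but one of the support elements are revealed, the last one has to be found. -/
lemma le_errorProb_of_energy {ν : Measure ℝ} {σ : ℝ} (hν : IsCoefficientPrior ν σ)
    (hT : 1 ≤ T) {snr : ℝ} (hs : 0 < snr) (D : Decoder N T) {K : ℕ} (hK : 1 ≤ K) (hKN : K ≤ N)
    {τ : ℝ} (hτ : 0 < τ) :
    1 - (Real.exp τ / (N - K + 1) + (1 / 2 + snr * σ ^ 2) / τ) ≤ errorProb ν K snr D := by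
  have := hν.isProbabilityMeasure
  obtain ⟨k, rfl⟩ : ∃ k, K = k + 1 := ⟨K - 1, by omega⟩
  rw [errorProb_eq ν hKN]
  -- For each revealed `S₀` the candidates are its one-point extensions; averaging over `S₀`
  -- recovers the uniform law on supports.
  have h1 : ∀ S₀ ∈ Finset.powersetCard k (Finset.univ : Finset (Fin N)), _ := fun S₀ hS₀ =>
    sum_law_estimate_eq_le_of_energy hν hT hs D S₀
      ((Finset.powersetCard (k + 1) (Finset.univ : Finset (Fin N))).filter (S₀ ⊆ ·)) (M := 1)
      (fun S hS => by
        rw [Finset.mem_filter, Finset.mem_powersetCard] at hS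
        refine ⟨hS.2, ?_⟩
        rw [Finset.card_sdiff_of_subset hS.2, hS.1.2, (Finset.mem_powersetCard.1 hS₀).2]
        omega) hτ
  have h2 := Finset.sum_le_sum h1
  rw [sum_powersetCard_supersets, Finset.sum_add_distrib, ← Finset.sum_mul, Finset.sum_const,
    Finset.card_powersetCard, Finset.card_univ, Fintype.card_fin, nsmul_eq_mul] at h2
  have h3 := sum_powersetCard_supersets (N := N) (fun _ => 1) k
  simp only [Finset.sum_const, nsmul_eq_mul, mul_one, Finset.card_powersetCard, Finset.card_univ,
    Fintype.card_fin] at h3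
  rw [h3] at h2
  have h4 : (N.choose (k + 1) : ℝ) * (k + 1) = N.choose k * (N - k) := by
    have := Nat.choose_succ_right_eq N k
    rw [← Nat.cast_sub (by omega)]
    exact_mod_cast this
  have h5 : (0 : ℝ) < N.choose (k + 1) := by exact_mod_cast Nat.choose_pos hKN
  have h6 : (0 : ℝ) < N - k := by
    rw [sub_pos]; exact_mod_cast hKN
  push_cast at *
  have h7 : (N : ℝ) - (k + 1) + 1 = N - k := by ring
  rw [h7]
  refine sub_le_sub_left ?_ _
  rw [div_le_iff₀ h5]
  refine le_of_mul_le_mul_left (h2.trans (le_of_eq ?_)) (by positivity : (0 : ℝ) < k + 1)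
  have h8 : Real.exp τ / (N - k) * N.choose (k + 1) * (k + 1) = N.choose k * Real.exp τ := by
    rw [mul_assoc, h4]
    field_simp
  linear_combination -h8

/-- Induction on `k`: `(m + 1).choose (k + 1) = (m + 1) / (k + 1) * m.choose k`, and `(m + 1) / (k +
1) ≤ m / k`. -/
lemma div_pow_le_choose {n k : ℕ} (hk : 1 ≤ k) (hkn : k ≤ n) :
    ((n : ℝ) / k) ^ k ≤ n.choose k := by
  induction k, hk using Nat.le_induction generalizing n with
  | base => simp
  | succ k hk ih =>
    obtain ⟨m, rfl⟩ : ∃ m, n = m + 1 := ⟨n - 1, by omega⟩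
    have h1 : ((m + 1 : ℕ) : ℝ) * m.choose k = (m + 1).choose (k + 1) * ((k + 1 : ℕ) : ℝ) := by
      exact_mod_cast Nat.add_one_mul_choose_eq m k
    have h2 : ((m + 1).choose (k + 1) : ℝ) = ((m + 1 : ℕ) : ℝ) / (k + 1 : ℕ) * m.choose k := by
      field_simp
      linarith
    have hk' : (0 : ℝ) < k := by positivity
    have hkm : (k : ℝ) ≤ m := by exact_mod_cast (by omega : k ≤ m)
    rw [h2, pow_succ']
    refine mul_le_mul_of_nonneg_left (le_trans ?_ (ih (by omega))) (by positivity)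
    refine pow_le_pow_left₀ (by positivity) ?_ _
    rw [div_le_div_iff₀ (by positivity) hk']
    push_cast
    nlinarith

lemma exp_le_choose {n k : ℕ} (hk : 1 ≤ k) (hkn : k ≤ n) :
    Real.exp (k * Real.log ((n : ℝ) / k)) ≤ n.choose k := by
  have hk' : (0 : ℝ) < k := by positivity
  have hn : (0 : ℝ) < n := hk'.trans_le (by exact_mod_cast hkn)
  refine le_trans (le_of_eq ?_) (div_pow_le_choose hk hkn)
  rw [mul_comm, ← Real.rpow_def_of_pos (by positivity), Real.rpow_natCast]

lemma le_errorProb_of_sum_le (ν : Measure ℝ) [IsProbabilityMeasure ν] {K : ℕ} (hK : 1 ≤ K)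
    (hKN : K ≤ N) (snr : ℝ) (D : Decoder N T) {τ e : ℝ}
    (h : ∑ S ∈ Finset.powersetCard K (Finset.univ : Finset (Fin N)),
      (law ν N T snr).real {ω | D.estimate (ω.1, observation S ω) = S}
      ≤ Real.exp τ + (Finset.powersetCard K (Finset.univ : Finset (Fin N))).card * (e / τ)) :
    1 - (Real.exp (τ - K * Real.log ((N : ℝ) / K)) + e / τ) ≤ errorProb ν K snr D := by
  rw [errorProb_eq ν hKN]
  rw [Finset.card_powersetCard, Finset.card_univ, Fintype.card_fin] at h
  have h5 : (0 : ℝ) < N.choose K := by exact_mod_cast Nat.choose_pos hKN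
  refine sub_le_sub_left ?_ _
  rw [div_le_iff₀ h5, add_mul]
  refine h.trans (add_le_add ?_ (le_of_eq (mul_comm _ _)))
  rw [Real.exp_sub, div_mul_eq_mul_div, le_div_iff₀ (Real.exp_pos _)]
  exact mul_le_mul_of_nonneg_left (exp_le_choose hK hKN) (Real.exp_pos _).le

/-! ### Elementary inequalities for logarithms. -/

/-- Bernoulli's inequality with exponent `t / s`. This monotonicity lets the number of samples be
replaced by its threshold value. -/
lemma mul_log_one_add_div_le {s t x : ℝ} (hs : 0 < s) (hst : s ≤ t) (hx : 0 ≤ x) :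
    s * Real.log (1 + x / s) ≤ t * Real.log (1 + x / t) := by
  have ht : 0 < t := hs.trans_le hst
  have hxt : 0 ≤ x / t := by positivity
  have h1 := one_add_mul_self_le_rpow_one_add (s := x / t) (by linarith) (p := t / s)
    ((one_le_div hs).2 hst)
  have h2 : t / s * (x / t) = x / s := by field_simp
  rw [h2] at h1
  have h3 := Real.log_le_log (by positivity) h1
  rw [Real.log_rpow (by positivity)] at h3
  calc s * Real.log (1 + x / s) ≤ s * (t / s * Real.log (1 + x / t)) := by gcongr
    _ = _ := by field_simp

lemma log_one_add_mul_le {x y : ℝ} (hx : 0 ≤ x) (hy : 0 ≤ y) :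
    Real.log (1 + x * y) ≤ Real.log (1 + x) + Real.log (1 + y) := by
  rw [← Real.log_mul (by positivity) (by positivity)]
  exact Real.log_le_log (by positivity) (by nlinarith)

/-- From `1 + x ≤ (1 + √x) ^ 2` follows `log (1 + x) ≤ 2 * √x`, and the rest is a completed square.
-/
lemma log_one_add_le_mul_add_inv {x a : ℝ} (hx : 0 ≤ x) (ha : 0 < a) :
    Real.log (1 + x) ≤ a * x + 1 / a := by
  have h1 : Real.log (1 + x) ≤ 2 * √x := by
    have h2 := log_one_add_mul_le (Real.sqrt_nonneg x) (Real.sqrt_nonneg x)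
    rw [Real.mul_self_sqrt hx] at h2
    have h3 := Real.log_le_sub_one_of_pos (x := 1 + √x) (by positivity)
    linarith
  refine h1.trans ?_
  have h2 : a * x + 1 / a - 2 * √x = a * (√x - 1 / a) ^ 2 := by
    have := Real.sq_sqrt hx
    field_simp
    linear_combination (-a ^ 2) * this
  have : 0 ≤ a * (√x - 1 / a) ^ 2 := by positivity
  linarith

lemma exp_neg_le_inv {x : ℝ} (hx : 0 < x) : Real.exp (-x) ≤ 1 / x := by
  rw [Real.exp_neg, one_div]
  exact inv_anti₀ hx (by linarith [Real.add_one_le_exp x])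

/-- Makes `K * log (N / K)` large uniformly in `K`, even for `K` linear in `N`. For `k ≤ √n` the
logarithm is at least half of `log n`; for larger `k` it is at least `log 2`, and `k` itself exceeds
`log n / 2`. -/
lemma log_div_four_le {n k : ℕ} (hk : 1 ≤ k) (hkn : 2 * k ≤ n) :
    Real.log n / 4 ≤ k * Real.log ((n : ℝ) / k) := by
  have hk' : (1 : ℝ) ≤ k := by exact_mod_cast hk
  have hkn' : 2 * (k : ℝ) ≤ n := by exact_mod_cast hkn
  have hn : (0 : ℝ) < n := by linarith
  have hlog2 : Real.log 2 ≤ Real.log ((n : ℝ) / k) :=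
    Real.log_le_log (by norm_num) (by rw [le_div_iff₀ (by linarith)]; linarith)
  have h2 := Real.log_two_gt_d9
  rcases le_total (Real.log k) (Real.log n / 2) with h | h
  · rw [Real.log_div (by positivity) (by positivity)] at *
    have : 0 ≤ Real.log n - Real.log k := by linarith
    have := Real.log_nonneg hk'
    nlinarith
  · have h1 := Real.log_le_sub_one_of_pos (x := (k : ℝ)) (by linarith)
    nlinarith

/-! ### The necessary conditions. -/

theorem exists_snr_necessary : ∃ c : ℝ, 0 < c ∧ ∀ (ν : Measure ℝ) (σ : ℝ), 0 < σ →
      IsCoefficientPrior ν σ →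
      ∀ (K T : ℕ → ℕ) (snr : ℕ → ℝ), IsScaling K T snr →
        IsNecessary ν K T snr (fun N => c / σ ^ 2 * Real.log N ≤ snr N) := by
  refine ⟨1 / 8, by norm_num, fun ν σ hσ hν K T snr hsc => ⟨1 / 4, by norm_num, fun D => ?_⟩⟩
  have hL : ∀ᶠ N : ℕ in atTop, 16 ≤ Real.log N :=
    (Real.tendsto_log_atTop.comp tendsto_natCast_atTop_atTop).eventually_ge_atTop 16
  filter_upwards [hsc, hL] with N ⟨hK, hKN, hT, hs⟩ hL hc
  have hN : (0 : ℝ) < N := by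
    rcases Nat.eq_zero_or_pos N with h | h
    · subst h; simp at hKN
    · exact_mod_cast h
  rw [not_le, div_mul_eq_mul_div, lt_div_iff₀ (by positivity)] at hc
  -- With this `τ` the first term is about `√N / N` and the second is about `2 * snr * σ ^ 2 / log
  -- N`, below `1 / 4` up to `1 / log N`.
  refine le_trans ?_ (le_errorProb_of_energy hν hT hs (D N) hK (by omega)
    (τ := Real.log N / 2) (by linarith))
  have hKN' : 2 * (K N : ℝ) ≤ N := by exact_mod_cast hKN.le
  have h1 : Real.exp (Real.log N / 2) / (N - K N + 1) ≤ 1 / 4 := by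
    have h2 : Real.exp (Real.log N / 2) * Real.exp (Real.log N / 2) = N := by
      rw [← Real.exp_add, add_halves, Real.exp_log hN]
    have h3 := Real.add_one_le_exp (Real.log N / 2)
    rw [div_le_iff₀ (by linarith)]
    nlinarith
  have h2 : (1 / 2 + snr N * σ ^ 2) / (Real.log N / 2) ≤ 1 / 2 := by
    rw [div_le_iff₀ (by linarith)]
    linarith
  linarith

theorem exists_samples_necessary (A : ℝ) (hA : 0 < A) : ∃ c : ℝ, 0 < c ∧
    ∀ (ν : Measure ℝ) (σ : ℝ), 0 < σ → IsCoefficientPrior ν σ →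
      ∀ (K T : ℕ → ℕ) (snr : ℕ → ℝ), IsScaling K T snr →
        (∀ᶠ N : ℕ in atTop, snr N ≤ A * Real.log ((N : ℝ) / (K N : ℝ))) →
        IsNecessary ν K T snr
          (fun N => c * ((K N : ℝ) * Real.log ((N : ℝ) / (K N : ℝ)) / Real.log (1 + σ ^ 2))
            ≤ (T N : ℝ)) := by
  set ℓ₀ := Real.log (1 + 1 / (8 * A)) with hℓ₀_def
  have hℓ₀ : 0 < ℓ₀ := Real.log_pos (by
    have : 0 < 1 / (8 * A) := by positivity
    linarith)
  -- The three bounds on `c` control the terms `c`, `r / x = c / ℓ` and `16 * A * c / ℓ` of the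
  -- final estimate, where `ℓ ≥ ℓ₀`.
  obtain ⟨c, hc0, hc1, hc2, hc3⟩ : ∃ c : ℝ, 0 < c ∧ c ≤ 1 / 16 ∧ c ≤ ℓ₀ / 32 ∧
      16 * A * c ≤ ℓ₀ / 16 := by
    refine ⟨min (1 / 16) (min (ℓ₀ / 32) (ℓ₀ / (256 * A))), by positivity, min_le_left _ _,
      (min_le_right _ _).trans (min_le_left _ _), ?_⟩
    have : min (1 / 16) (min (ℓ₀ / 32) (ℓ₀ / (256 * A))) ≤ ℓ₀ / (256 * A) :=
      (min_le_right _ _).trans (min_le_right _ _)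
    rw [le_div_iff₀ (by positivity)] at this
    linarith
  refine ⟨c, hc0, fun ν σ hσ hν K T snr hsc hsnr => ⟨1 / 4, by norm_num, fun D => ?_⟩⟩
  have := hν.isProbabilityMeasure
  have hL : ∀ᶠ N : ℕ in atTop, 64 ≤ Real.log N :=
    (Real.tendsto_log_atTop.comp tendsto_natCast_atTop_atTop).eventually_ge_atTop 64
  filter_upwards [hsc, hL, hsnr] with N ⟨hK, hKN, hT, hs⟩ hL hsnr hc
  have hx := log_div_four_le hK hKN.le
  set l := Real.log ((N : ℝ) / K N)
  have hK' : (0 : ℝ) < K N := by positivity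
  have hT' : (0 : ℝ) < T N := by positivity
  set x : ℝ := K N * l with hx_def
  have hx16 : 16 ≤ x := by linarith
  have hl : 0 < l := pos_of_mul_pos_right (by linarith : 0 < K N * l) hK'.le
  -- With `τ = x / 2`, half of the entropy bound `x`, a mean `e ≤ x / 4` costs at most half of the
  -- success probability.
  suffices ∃ e, e ≤ x / 4 ∧ ∑ S ∈ Finset.powersetCard (K N) (Finset.univ : Finset (Fin N)),
      (law ν N (T N) (snr N)).real {ω | (D N).estimate (ω.1, observation S ω) = S}
      ≤ Real.exp (x / 2)
        + (Finset.powersetCard (K N) (Finset.univ : Finset (Fin N))).card * (e / (x / 2)) by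
    obtain ⟨e, he, h⟩ := this
    refine le_trans ?_ (le_errorProb_of_sum_le ν hK (by omega) (snr N) (D N) h)
    have h1 : Real.exp (x / 2 - x) ≤ 1 / 8 := by
      rw [show x / 2 - x = -(x / 2) by ring]
      refine (exp_neg_le_inv (by linarith)).trans ?_
      rw [div_le_div_iff₀ (by linarith) (by norm_num)]
      linarith
    have h2 : e / (x / 2) ≤ 1 / 2 := by
      rw [div_le_iff₀ (by linarith)]
      linarith
    linarith
  -- For small `σ ^ 2` the total energy times `snr` is at most `x / 8`, so recovery fails whatever
  -- the number of samples. Otherwise `log (1 + σ ^ 2) ≥ ℓ₀` and the capacity bound applies.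
  rcases le_total (σ ^ 2) (1 / (8 * A)) with h | h
  · refine ⟨1 / 2 + snr N * (K N * σ ^ 2), ?_, sum_law_estimate_eq_le_of_energy hν hT hs (D N) ∅ _
      (M := K N) (fun S hS => ⟨Finset.empty_subset _, ?_⟩) (by linarith)⟩
    · rw [le_div_iff₀ (by positivity)] at h
      have : snr N * (K N * σ ^ 2) ≤ A * l * (K N * σ ^ 2) := by gcongr
      nlinarith
    · rw [Finset.sdiff_empty, (Finset.mem_powersetCard.1 hS).2]
  · refine ⟨T N / 2 * Real.log (1 + K N * σ ^ 2 * snr N / T N) + T N, ?_,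
      sum_law_estimate_eq_le_of_samples hν hT hs (D N) _
        (fun S hS => (Finset.mem_powersetCard.1 hS).2) (by linarith)⟩
    set ℓ := Real.log (1 + σ ^ 2)
    have hℓ : ℓ₀ ≤ ℓ := Real.log_le_log (by positivity) (by linarith)
    have hℓpos : 0 < ℓ := hℓ₀.trans_le hℓ
    rw [not_le] at hc
    set r : ℝ := c * (x / ℓ) with hr
    have hrpos : 0 < r := hT'.trans hc
    have h1 : T N * Real.log (1 + K N * σ ^ 2 * snr N / T N)
        ≤ r * (ℓ + (1 / (16 * A) * (A * ℓ / c) + 1 / (1 / (16 * A)))) := by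
      calc T N * Real.log (1 + K N * σ ^ 2 * snr N / T N)
          ≤ T N * Real.log (1 + K N * σ ^ 2 * (A * l) / T N) := by gcongr
        _ ≤ r * Real.log (1 + K N * σ ^ 2 * (A * l) / r) :=
            mul_log_one_add_div_le hT' hc.le (by positivity)
        _ = r * Real.log (1 + σ ^ 2 * (A * ℓ / c)) := by
            congr 3
            rw [hr, hx_def]
            field_simp
        _ ≤ r * (ℓ + Real.log (1 + A * ℓ / c)) := by
            gcongr
            exact log_one_add_mul_le (by positivity) (by positivity)
        _ ≤ _ := by
            gcongr
            -- The parameter `1 / (16 * A)` turns the linear term, once multiplied by `r = c * x /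
            -- ℓ`, into exactly `x / 16`.
            exact log_one_add_le_mul_add_inv (by positivity) (by positivity)
    have h2 : r * (ℓ + (1 / (16 * A) * (A * ℓ / c) + 1 / (1 / (16 * A))))
        = x * (c + 1 / 16 + 16 * A * c / ℓ) := by
      rw [hr]; field_simp; ring
    have h3 : 16 * A * c / ℓ ≤ 1 / 16 := by
      rw [div_le_iff₀ hℓpos]; linarith
    have h4 : r ≤ x / 32 := by
      rw [hr, mul_div_assoc', div_le_iff₀ hℓpos]
      nlinarith
    have h5 : x * (c + 1 / 16 + 16 * A * c / ℓ) ≤ x * (3 / 16) := by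
      gcongr
      linarith
    linarith

theorem exists_samples_necessary_sublinear (A η : ℝ) (hA : 0 < A) (hη : 0 < η) : ∃ c : ℝ, 0 < c ∧
    ∀ (ν : Measure ℝ) (σ : ℝ), 0 < σ → IsCoefficientPrior ν σ →
      ∀ (K T : ℕ → ℕ) (snr : ℕ → ℝ), IsScaling K T snr →
        (∀ᶠ N : ℕ in atTop, (K N : ℝ) ≤ (N : ℝ) ^ (1 - η)) →
        (∀ᶠ N : ℕ in atTop, snr N ≤ A * Real.log N) →
        IsNecessary ν K T snr
          (fun N => c * ((K N : ℝ) * Real.log ((N : ℝ) / (K N : ℝ)) / Real.log (1 + σ ^ 2))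
            ≤ (T N : ℝ)) := by
  -- If `K ≤ N ^ (1 - η)` then `log (N / K) ≥ η * log N`.
  obtain ⟨c, hc, h⟩ := exists_samples_necessary (A / η) (by positivity)
  refine ⟨c, hc, fun ν σ hσ hν K T snr hsc hK hsnr => h ν σ hσ hν K T snr hsc ?_⟩
  filter_upwards [hsc, hK, hsnr] with N ⟨hK1, hKN, _, _⟩ hK hsnr
  have hK' : (0 : ℝ) < K N := by exact_mod_cast hK1
  have hN : (0 : ℝ) < N := by
    have : 0 < N := by omega
    exact_mod_cast this
  have h1 := Real.log_le_log hK' hK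
  rw [Real.log_rpow hN] at h1
  rw [Real.log_div hN.ne' hK'.ne', div_mul_eq_mul_div, le_div_iff₀ hη]
  nlinarith

/-! ### The nearest grid vector decoder. -/

lemma measurePreserving_coefficients (ν : Measure ℝ) [IsProbabilityMeasure ν] (snr : ℝ) :
    MeasurePreserving (fun ω : (Fin T → Fin N → ℝ) × (Fin N → ℝ) × (Fin T → ℝ) => ω.2.1)
      (law ν N T snr) (Measure.pi fun _ => ν) :=
  measurePreserving_fst.comp measurePreserving_snd

/-- Measurable disjoint regions can be decoded. -/
lemma exists_decoder (F : Finset (Finset (Fin N)))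
    (G : Finset (Fin N) → Set ((Fin T → Fin N → ℝ) × (Fin T → ℝ)))
    (hG : ∀ S, MeasurableSet (G S))
    (hd : ∀ S ∈ F, ∀ S' ∈ F, S' ≠ S → Disjoint (G S) (G S')) :
    ∃ D : Decoder N T, ∀ S ∈ F, ∀ p ∈ G S, D.estimate p = S := by
  classical
  -- The union of all candidates whose region contains `p`: on a region there is exactly one
  -- candidate, and elsewhere the value is irrelevant.
  refine ⟨⟨fun p => (F.filter fun S => p ∈ G S).sup id, fun S => ?_⟩, fun S hS p hp => ?_⟩
  · have h1 : (fun p => (F.filter fun S => p ∈ G S).sup id) ⁻¹' {S}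
        = ⋃ U ∈ {U : Finset (Finset (Fin N)) | U.sup id = S},
          ⋂ S', {p | (S' ∈ F ∧ p ∈ G S') ↔ S' ∈ U} := by
      ext p
      simp only [Set.mem_preimage, Set.mem_singleton_iff, Set.mem_ofPred_eq, Set.mem_iUnion,
        Set.mem_iInter, exists_prop]
      refine ⟨fun h => ⟨_, h, fun S' => by rw [Finset.mem_filter]⟩, fun ⟨U, hU, h⟩ => ?_⟩
      rw [← hU]
      congr 1
      ext S'
      rw [Finset.mem_filter, h]
    rw [h1]
    refine MeasurableSet.biUnion (Set.to_countable _) fun U _ => MeasurableSet.iInter fun S' => ?_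
    exact ((MeasurableSet.const _).inter (hG S')).iff (MeasurableSet.const _)
  · have h1 : F.filter (fun S => p ∈ G S) = {S} := by
      ext S'
      rw [Finset.mem_filter, Finset.mem_singleton]
      refine ⟨fun h => ?_, fun h => h ▸ ⟨hS, hp⟩⟩
      by_contra hne
      exact Set.disjoint_left.1 (hd S hS S' h.1 hne) hp h.2
    simp [h1]

/-- Integer vectors supported on `S` with entries of absolute value at most `R`. -/
noncomputable def integerGrid (R : ℕ) (S : Finset (Fin N)) : Finset (Fin N → ℤ) :=
  Fintype.piFinset fun n => if n ∈ S then Finset.Icc (-R : ℤ) R else {0}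

lemma card_integerGrid (R : ℕ) (S : Finset (Fin N)) :
    (integerGrid R S).card = (2 * R + 1) ^ S.card := by
  rw [integerGrid, Fintype.card_piFinset]
  have h1 : ∀ n, (if n ∈ S then Finset.Icc (-R : ℤ) R else {0}).card
      = if n ∈ S then 2 * R + 1 else 1 := fun n => by
    split_ifs
    · rw [Int.card_Icc]; omega
    · simp
  simp_rw [h1]
  rw [Finset.prod_ite_mem, Finset.univ_inter, Finset.prod_const]

/-- The squared distance of the observation from the signal with coefficients `Δ * m`. -/
noncomputable def residual (Δ : ℝ) (p : (Fin T → Fin N → ℝ) × (Fin T → ℝ)) (m : Fin N → ℤ) : ℝ :=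
  ∑ t, (p.2 t - ∑ n, p.1 t n * (Δ * m n)) ^ 2

lemma measurable_residual (Δ : ℝ) (m : Fin N → ℤ) :
    Measurable fun p : (Fin T → Fin N → ℝ) × (Fin T → ℝ) => residual Δ p m := by
  unfold residual
  fun_prop

/-- The data for which some grid vector supported on `S` is strictly closer to the observation than
all those with another support of size `K`. -/
def nearestRegion (Δ : ℝ) (R K : ℕ) (S : Finset (Fin N)) :
    Set ((Fin T → Fin N → ℝ) × (Fin T → ℝ)) :=
  ⋃ m ∈ integerGrid R S, ⋂ S' ∈ (Finset.powersetCard K (Finset.univ : Finset (Fin N))).erase S,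
    ⋂ m' ∈ integerGrid R S', {p | residual Δ p m < residual Δ p m'}

lemma measurableSet_nearestRegion (Δ : ℝ) (R K : ℕ) (S : Finset (Fin N)) :
    MeasurableSet (nearestRegion (T := T) Δ R K S) :=
  Finset.measurableSet_biUnion _ fun m _ => Finset.measurableSet_biInter _ fun _ _ =>
    Finset.measurableSet_biInter _ fun m' _ =>
      measurableSet_lt (measurable_residual Δ m) (measurable_residual Δ m')

lemma exists_nearest_decoder (Δ : ℝ) (R K : ℕ) : ∃ D : Decoder N T,
    ∀ S ∈ Finset.powersetCard K (Finset.univ : Finset (Fin N)), ∀ p ∈ nearestRegion Δ R K S,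
      D.estimate p = S := by
  refine exists_decoder _ _ (measurableSet_nearestRegion Δ R K) fun S hS S' hS' hne =>
    Set.disjoint_left.2 fun p hp hp' => ?_
  simp only [nearestRegion, Set.mem_iUnion, Set.mem_iInter, exists_prop, Set.mem_ofPred_eq] at hp hp'
  obtain ⟨m, hm, h⟩ := hp
  obtain ⟨m', hm', h'⟩ := hp'
  exact lt_asymm (h S' (Finset.mem_erase.2 ⟨hne, hS'⟩) m' hm')
    (h' S (Finset.mem_erase.2 ⟨hne.symm, hS⟩) m hm)

/-! ### Probabilities of the error events. -/

lemma lintegral_exp_neg_sum_sq_signal {s : ℝ} (hs : 0 ≤ s) (d : Fin N → ℝ) :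
    ∫⁻ x, ENNReal.ofReal (Real.exp (-(s * ∑ t, (∑ n, x t n * d n) ^ 2)))
        ∂(Measure.pi fun _ : Fin T => Measure.pi fun _ : Fin N =>
          gaussianReal 0 (Real.toNNReal (1 / (T : ℝ))))
      = ENNReal.ofReal ((1 + 2 * s * (∑ n, d n ^ 2) / T) ^ (-(T / 2) : ℝ)) := by
  have hd : 0 ≤ ∑ n, d n ^ 2 := Finset.sum_nonneg fun n _ => sq_nonneg _
  simp_rw [Finset.mul_sum, ← Finset.sum_neg_distrib, Real.exp_sum,
    ENNReal.ofReal_prod_of_nonneg fun i (_ : i ∈ Finset.univ) => (Real.exp_pos _).le]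
  rw [lintegral_pi_prod _ (fun (_ : Fin T) (r : Fin N → ℝ) =>
    ENNReal.ofReal (Real.exp (-(s * (∑ n, r n * d n) ^ 2)))) fun _ => by fun_prop]
  have h1 := lintegral_map
    (μ := Measure.pi fun _ : Fin N => gaussianReal 0 (Real.toNNReal (1 / (T : ℝ))))
    (f := fun x : ℝ => ENNReal.ofReal (Real.exp (-(s * x ^ 2)))) (g := fun x => ∑ i, d i * x i)
    (by fun_prop) (by fun_prop)
  rw [pi_gaussianReal_map_sum, lintegral_exp_neg_sq_gaussianReal _ hs, NNReal.coe_mul,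
    Real.coe_toNNReal _ (by positivity), Real.coe_toNNReal _ hd] at h1
  simp_rw [mul_comm (d _)] at h1
  rw [← h1, Finset.prod_const, Finset.card_univ, Fintype.card_fin,
    ← ENNReal.ofReal_pow (by positivity), ← Real.rpow_natCast, ← Real.rpow_mul (by positivity)]
  congr 2
  · rw [← Finset.mul_sum, mul_div_assoc, one_div, div_eq_inv_mul]
  · ring

/-- The integer vector of the rounded coefficients on `S`, in units of `Δ`. -/
noncomputable def quantize (Δ : ℝ) (S : Finset (Fin N)) (b : Fin N → ℝ) (n : Fin N) : ℤ :=
  if n ∈ S then ⌊b n / Δ⌋ else 0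

lemma measurable_quantize (Δ : ℝ) (S : Finset (Fin N)) (n : Fin N) :
    Measurable fun b => quantize Δ S b n := by
  unfold quantize
  split_ifs
  · exact Int.measurable_floor.comp (by fun_prop)
  · fun_prop

lemma quantize_mem_integerGrid {Δ : ℝ} (hΔ : 0 < Δ) {R : ℕ} {S : Finset (Fin N)} {b : Fin N → ℝ}
    (hb : ∀ n ∈ S, |b n| ≤ R * Δ) : quantize Δ S b ∈ integerGrid R S := by
  rw [integerGrid, Fintype.mem_piFinset]
  intro n
  unfold quantize
  split_ifs with h
  · have h1 := abs_le.1 (hb n h)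
    rw [Finset.mem_Icc]
    constructor
    · rw [Int.le_floor, le_div_iff₀ hΔ]
      push_cast
      linarith
    · have : ⌊b n / Δ⌋ ≤ ⌊(R : ℝ)⌋ := Int.floor_le_floor (by rw [div_le_iff₀ hΔ]; exact h1.2)
      simpa using this
  · simp

lemma abs_sparseVector_sub_quantize_le {Δ : ℝ} (hΔ : 0 < Δ) (S : Finset (Fin N)) (b : Fin N → ℝ)
    {n : Fin N} : |sparseVector S b n - Δ * quantize Δ S b n| ≤ if n ∈ S then Δ else 0 := by
  unfold quantize sparseVector
  split_ifs with h
  · have h1 := Int.floor_le (b n / Δ)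
    have h2 := Int.lt_floor_add_one (b n / Δ)
    rw [le_div_iff₀ hΔ] at h1
    rw [div_lt_iff₀ hΔ] at h2
    rw [abs_le]
    constructor <;> linarith
  · simp

/-- The quantized truth loses against a competing grid vector only with the probability given by a
Chernoff bound. -/
lemma law_residual_le_le (ν : Measure ℝ) [IsProbabilityMeasure ν] (hT : 1 ≤ T) {snr : ℝ}
    (hs : 0 < snr) {Δ β : ℝ} (hΔ : 0 < Δ) (hβ : 2 * Δ ≤ β) (S S' : Finset (Fin N)) {R : ℕ}
    {m' : Fin N → ℤ} (hm' : m' ∈ integerGrid R S') :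
    law ν N T snr {ω | (∀ n ∈ S, β ≤ |ω.2.1 n|)
        ∧ snr * ∑ t, (∑ n, ω.1 t n *
          (sparseVector S ω.2.1 n - Δ * quantize Δ S ω.2.1 n)) ^ 2 ≤ 1
        ∧ residual Δ (ω.1, observation S ω) m'
          ≤ residual Δ (ω.1, observation S ω) (quantize Δ S ω.2.1)}
      ≤ ENNReal.ofReal (Real.exp 1 *
        (1 + (S \ S').card * (snr * β ^ 2 / 32) / T) ^ (-(T / 2) : ℝ)) := by
  classical
  have hT' : (0 : ℝ) < T := by positivity
  set u : (Fin T → Fin N → ℝ) → (Fin N → ℝ) → Fin T → ℝ := fun x b t =>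
    ∑ n, x t n * (Δ * quantize Δ S b n - Δ * m' n) with hu
  -- The Chernoff exponent: `snr / 4` times the difference of residuals, with the rounding error `e`
  -- removed at the cost of the constant `1`. Integrating out the noise adds `snr / 8 * ‖u‖²`,
  -- leaving `1 - snr / 16 * ‖u‖²`.
  set g : (Fin T → Fin N → ℝ) × (Fin N → ℝ) × (Fin T → ℝ) → ℝ := fun ω =>
    1 - 3 * snr / 16 * ∑ t, u ω.1 ω.2.1 t ^ 2 + ∑ t, (-(snr / 2) * u ω.1 ω.2.1 t) * ω.2.2 t with hg
  have hum : ∀ t, Measurable fun ω : (Fin T → Fin N → ℝ) × (Fin N → ℝ) × (Fin T → ℝ) =>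
      u ω.1 ω.2.1 t := fun t => by
    have h1 : ∀ n, Measurable fun ω : (Fin T → Fin N → ℝ) × (Fin N → ℝ) × (Fin T → ℝ) =>
        ((quantize Δ S ω.2.1 n : ℤ) : ℝ) := fun n =>
      (measurable_of_countable (fun k : ℤ => (k : ℝ))).comp
        ((measurable_quantize Δ S n).comp (by fun_prop))
    simp only [hu]
    fun_prop
  have hgm : Measurable g := by
    exact (measurable_const.sub ((Finset.measurable_sum _ fun t _ =>
      (hum t).pow_const 2).const_mul _)).add (Finset.measurable_sum _ fun t _ =>
        ((hum t).const_mul _).mul (by fun_prop))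
  have hgood : MeasurableSet {ω : (Fin T → Fin N → ℝ) × (Fin N → ℝ) × (Fin T → ℝ) |
      ∀ n ∈ S, β ≤ |ω.2.1 n|} := by
    have : {ω : (Fin T → Fin N → ℝ) × (Fin N → ℝ) × (Fin T → ℝ) | ∀ n ∈ S, β ≤ |ω.2.1 n|}
        = ⋂ n ∈ S, {ω | β ≤ |ω.2.1 n|} := by ext; simp
    rw [this]
    exact Finset.measurableSet_biInter _ fun n _ => measurableSet_le (by fun_prop)
      (measurable_abs.comp (by fun_prop))
  have hfm : Measurable fun ω => if ω ∈ {ω : (Fin T → Fin N → ℝ) × (Fin N → ℝ) × (Fin T → ℝ) |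
      ∀ n ∈ S, β ≤ |ω.2.1 n|} then ENNReal.ofReal (Real.exp (g ω)) else 0 :=
    Measurable.ite hgood (hgm.exp.ennreal_ofReal) measurable_const
  have key : ∀ ω : (Fin T → Fin N → ℝ) × (Fin N → ℝ) × (Fin T → ℝ),
      snr * ∑ t, (∑ n, ω.1 t n *
          (sparseVector S ω.2.1 n - Δ * quantize Δ S ω.2.1 n)) ^ 2 ≤ 1 →
      residual Δ (ω.1, observation S ω) m'
          ≤ residual Δ (ω.1, observation S ω) (quantize Δ S ω.2.1) → 0 ≤ g ω := by
    rintro ⟨x, b, w⟩ h1 h2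
    simp only [residual, observation] at h1 h2
    set e : Fin T → ℝ := fun t => ∑ n, x t n * (sparseVector S b n - Δ * quantize Δ S b n) with he
    have h3 : ∀ t, ∑ n, x t n * sparseVector S b n + w t - ∑ n, x t n * (Δ * quantize Δ S b n)
        = e t + w t := fun t => by
      simp only [he, mul_sub, Finset.sum_sub_distrib]; ring
    have h4 : ∀ t, ∑ n, x t n * sparseVector S b n + w t - ∑ n, x t n * (Δ * m' n)
        = e t + w t + u x b t := fun t => by
      simp only [he, hu, mul_sub, Finset.sum_sub_distrib]; ring
    simp_rw [h3, h4] at h2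
    -- Completing the square in `e` absorbs the cross term between `e` and `u`; on the event every
    -- group on the right is nonnegative.
    have h5 : g (x, b, w) = 1 - snr * ∑ t, e t ^ 2
        + snr / 4 * (∑ t, (e t + w t) ^ 2 - ∑ t, (e t + w t + u x b t) ^ 2)
        + snr * ∑ t, (e t + u x b t / 4) ^ 2 := by
      simp only [hg]
      rw [← Finset.sum_sub_distrib, Finset.mul_sum, Finset.mul_sum, Finset.mul_sum, Finset.mul_sum,
        sub_add, sub_add, sub_add, ← Finset.sum_sub_distrib, ← Finset.sum_sub_distrib,
        ← Finset.sum_sub_distrib]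
      congr 1
      exact Finset.sum_congr rfl fun t _ => by ring
    have h6 : 0 ≤ ∑ t, (e t + u x b t / 4) ^ 2 := Finset.sum_nonneg fun t _ => sq_nonneg _
    have h7 : 0 ≤ snr / 4 * (∑ t, (e t + w t) ^ 2 - ∑ t, (e t + w t + u x b t) ^ 2) :=
      mul_nonneg (by positivity) (sub_nonneg.2 h2)
    rw [h5]
    have := mul_nonneg hs.le h6
    linarith
  refine le_trans (measure_mono (t := {ω | 1 ≤ if ω ∈ {ω : (Fin T → Fin N → ℝ) × (Fin N → ℝ) ×
      (Fin T → ℝ) | ∀ n ∈ S, β ≤ |ω.2.1 n|} then ENNReal.ofReal (Real.exp (g ω)) else 0})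
      fun ω hω => ?_) ((meas_ge_le_lintegral_div hfm.aemeasurable one_ne_zero
        ENNReal.one_ne_top).trans ?_)
  · simp only [Set.mem_ofPred_eq] at hω ⊢
    rw [if_pos hω.1, ENNReal.one_le_ofReal]
    exact Real.one_le_exp (key ω hω.2.1 hω.2.2)
  rw [div_one, lintegral_law _ _ hfm]
  have hconst : ∀ c : ℝ≥0∞, c = ∫⁻ _, c ∂(Measure.pi fun _ : Fin N => ν) := fun c => by simp
  rw [hconst (ENNReal.ofReal (Real.exp 1 * _))]
  refine lintegral_mono fun b => ?_
  by_cases hb : ∀ n ∈ S, β ≤ |b n|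
  swap
  · rw [lintegral_congr fun x => lintegral_congr fun w => if_neg (show (x, b, w) ∉ _ from hb)]
    simp
  have h1 : ∀ x : Fin T → Fin N → ℝ, ∫⁻ w, (if (x, b, w) ∈ {ω : (Fin T → Fin N → ℝ) ×
      (Fin N → ℝ) × (Fin T → ℝ) | ∀ n ∈ S, β ≤ |ω.2.1 n|} then
        ENNReal.ofReal (Real.exp (g (x, b, w))) else 0)
        ∂(Measure.pi fun _ : Fin T => gaussianReal 0 (Real.toNNReal (1 / snr)))
      = ENNReal.ofReal (Real.exp 1) *
        ENNReal.ofReal (Real.exp (-(snr / 16 * ∑ t, u x b t ^ 2))) := fun x => by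
    rw [lintegral_congr fun w => if_pos (show (x, b, w) ∈ _ from hb)]
    simp only [hg, Real.exp_add _ (∑ t, _)]
    simp_rw [ENNReal.ofReal_mul (Real.exp_pos _).le]
    rw [lintegral_const_mul _ (by fun_prop), lintegral_exp_pi_gaussianReal,
      ← ENNReal.ofReal_mul (Real.exp_pos _).le, ← ENNReal.ofReal_mul (Real.exp_pos _).le,
      ← Real.exp_add, ← Real.exp_add, Real.coe_toNNReal _ (by positivity)]
    congr 2
    simp_rw [mul_pow]
    rw [← Finset.mul_sum]
    field_simp
    ring
  rw [lintegral_congr h1, lintegral_const_mul' _ _ ENNReal.ofReal_ne_top, hu]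
  rw [lintegral_exp_neg_sum_sq_signal (by positivity), ENNReal.ofReal_mul (Real.exp_pos _).le]
  refine mul_le_mul' le_rfl (ENNReal.ofReal_le_ofReal ?_)
  -- On `S \ S'` the competitor vanishes, while the rounded coefficient is at least `β - Δ ≥ β / 2`
  -- in absolute value.
  have h2 : (S \ S').card * (β / 2) ^ 2 ≤ ∑ n, (Δ * quantize Δ S b n - Δ * m' n) ^ 2 := by
    rw [← nsmul_eq_mul, ← Finset.sum_const]
    refine le_trans (Finset.sum_le_sum fun n hn => ?_) (Finset.sum_le_sum_of_subset_of_nonneg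
      (Finset.subset_univ (S \ S')) fun n _ _ => sq_nonneg _)
    rw [Finset.mem_sdiff] at hn
    have h3 : m' n = 0 := by
      have := Fintype.mem_piFinset.1 hm' n
      simpa [hn.2] using this
    have h4 := abs_sparseVector_sub_quantize_le hΔ S b (n := n)
    have h5 := hb n hn.1
    simp only [sparseVector, if_pos hn.1] at h4
    rw [h3, ← sq_abs (_ - _)]
    refine pow_le_pow_left₀ (by linarith) ?_ 2
    have h6 := abs_sub_abs_le_abs_sub (b n) (Δ * quantize Δ S b n)
    simp only [Int.cast_zero, mul_zero, sub_zero]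
    linarith
  have hi : (0 : ℝ) ≤ (S \ S').card := Nat.cast_nonneg _
  generalize ((S \ S').card : ℝ) = i at h2 hi
  refine Real.rpow_le_rpow_of_nonpos (by positivity) ?_ (by linarith)
  have h3 : i * (snr * β ^ 2 / 32) ≤
      2 * (snr / 16) * ∑ n, (Δ * quantize Δ S b n - Δ * m' n) ^ 2 := by
    nlinarith
  gcongr

/-- Markov's inequality: `X` preserves the energy of the rounding error on average, and each
coordinate in `S` is off by at most `Δ`. -/
lemma law_quantization_error_le (ν : Measure ℝ) [IsProbabilityMeasure ν] (hT : 1 ≤ T) {snr : ℝ}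
    (hs : 0 < snr) {Δ : ℝ} (hΔ : 0 < Δ) (S : Finset (Fin N)) :
    law ν N T snr {ω | 1 ≤ snr * ∑ t, (∑ n, ω.1 t n *
          (sparseVector S ω.2.1 n - Δ * quantize Δ S ω.2.1 n)) ^ 2}
      ≤ ENNReal.ofReal (snr * (S.card * Δ ^ 2)) := by
  have hq : ∀ n, Measurable fun ω : (Fin T → Fin N → ℝ) × (Fin N → ℝ) × (Fin T → ℝ) =>
      sparseVector S ω.2.1 n - Δ * quantize Δ S ω.2.1 n := fun n => by
    refine ((measurable_sparseVector S n).comp (by fun_prop)).sub (Measurable.const_mul ?_ _)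
    exact (measurable_of_countable (fun k : ℤ => (k : ℝ))).comp
      ((measurable_quantize Δ S n).comp (by fun_prop))
  have hm : Measurable fun ω : (Fin T → Fin N → ℝ) × (Fin N → ℝ) × (Fin T → ℝ) =>
      ENNReal.ofReal (snr * ∑ t, (∑ n, ω.1 t n *
          (sparseVector S ω.2.1 n - Δ * quantize Δ S ω.2.1 n)) ^ 2) :=
    ((Finset.measurable_sum _ fun t _ => (Finset.measurable_sum _ fun n _ =>
      Measurable.mul (by fun_prop) (hq n)).pow_const 2).const_mul _).ennreal_ofReal
  refine le_trans (measure_mono fun ω hω => ?_)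
    ((meas_ge_le_lintegral_div hm.aemeasurable one_ne_zero ENNReal.one_ne_top).trans ?_)
  · exact ENNReal.one_le_ofReal.2 hω
  rw [div_one, lintegral_law _ _ hm]
  have hconst : ∀ c : ℝ≥0∞, c = ∫⁻ _, c ∂(Measure.pi fun _ : Fin N => ν) := fun c => by simp
  rw [hconst (ENNReal.ofReal (snr * (S.card * Δ ^ 2)))]
  refine lintegral_mono fun b => ?_
  simp only [lintegral_const, measure_univ, mul_one]
  simp_rw [ENNReal.ofReal_mul hs.le]
  rw [lintegral_const_mul' _ _ ENNReal.ofReal_ne_top, lintegral_sum_sq_signal hT]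
  refine mul_le_mul' le_rfl (ENNReal.ofReal_le_ofReal ?_)
  calc ∑ n, (sparseVector S b n - Δ * quantize Δ S b n) ^ 2
      ≤ ∑ n, (if n ∈ S then Δ ^ 2 else 0) := Finset.sum_le_sum fun n _ => by
        have h1 := abs_sparseVector_sub_quantize_le hΔ S b (n := n)
        rw [← sq_abs]
        split_ifs at h1 ⊢
        · exact pow_le_pow_left₀ (abs_nonneg _) h1 2
        · simp [le_antisymm h1 (abs_nonneg _)]
    _ = _ := by simp [Finset.sum_ite_mem]

lemma law_coefficient_large_le {ν : Measure ℝ} {σ : ℝ} (hν : IsCoefficientPrior ν σ) (snr : ℝ)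
    (S : Finset (Fin N)) {B : ℝ} (hB : 0 < B) :
    law ν N T snr {ω | B ≤ ∑ n ∈ S, ω.2.1 n ^ 2} ≤ ENNReal.ofReal (S.card * σ ^ 2 / B) := by
  have := hν.isProbabilityMeasure
  have h1 := (measurePreserving_coefficients (N := N) (T := T) ν snr).lintegral_comp
    (f := fun b => ENNReal.ofReal (∑ n ∈ S, b n ^ 2)) (by fun_prop)
  rw [lintegral_sum_sq_coefficients hν] at h1
  rw [ENNReal.ofReal_div_of_pos hB, ← h1]
  refine le_trans (measure_mono fun ω hω => ?_) (meas_ge_le_lintegral_div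
    (by fun_prop) (by simpa using hB) ENNReal.ofReal_ne_top)
  exact ENNReal.ofReal_le_ofReal hω

lemma law_coefficient_small {ν : Measure ℝ} [IsProbabilityMeasure ν] (snr : ℝ) {β : ℝ}
    (hβ : ∀ᵐ x ∂ν, β ≤ |x|) (S : Finset (Fin N)) :
    law ν N T snr {ω | ¬ ∀ n ∈ S, β ≤ |ω.2.1 n|} = 0 := by
  have h1 : ∀ n, ∀ᵐ ω ∂law ν N T snr, β ≤ |ω.2.1 n| := fun n =>
    (((measurePreserving_eval (fun _ : Fin N => ν) n).comp (measurePreserving_coefficients (T := T)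
      ν snr)).quasiMeasurePreserving.ae hβ)
  have h2 : ∀ᵐ ω ∂law ν N T snr, ∀ n ∈ S, β ≤ |ω.2.1 n| := by
    filter_upwards [ae_all_iff.2 h1] with ω hω n _ using hω n
  exact h2

/-- Union bound for the error of the nearest grid vector decoder. -/
lemma law_real_nearest_ne_le {ν : Measure ℝ} {σ : ℝ} (hν : IsCoefficientPrior ν σ) (hT : 1 ≤ T)
    {snr : ℝ} (hs : 0 < snr) {Δ β : ℝ} (hΔ : 0 < Δ) (hβΔ : 2 * Δ ≤ β) (hβ : ∀ᵐ x ∂ν, β ≤ |x|)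
    {R K : ℕ} (hR : 1 ≤ R) {D : Decoder N T}
    (hD : ∀ S ∈ Finset.powersetCard K (Finset.univ : Finset (Fin N)), ∀ p ∈ nearestRegion Δ R K S,
      D.estimate p = S) {S : Finset (Fin N)}
    (hS : S ∈ Finset.powersetCard K (Finset.univ : Finset (Fin N))) :
    (law ν N T snr).real {ω | D.estimate (ω.1, observation S ω) ≠ S}
      ≤ K * σ ^ 2 / (R * Δ) ^ 2 + snr * (K * Δ ^ 2)
        + ∑ S' ∈ (Finset.powersetCard K (Finset.univ : Finset (Fin N))).erase S,
          (2 * R + 1) ^ K * (Real.exp 1 *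
            (1 + (S \ S').card * (snr * β ^ 2 / 32) / T) ^ (-(T / 2) : ℝ)) := by
  have := hν.isProbabilityMeasure
  have hcard := (Finset.mem_powersetCard.1 hS).2
  have hRΔ : 0 < R * Δ := by positivity
  set E : Finset (Fin N) → (Fin N → ℤ) → Set ((Fin T → Fin N → ℝ) × (Fin N → ℝ) × (Fin T → ℝ)) :=
    fun S' m' => {ω | (∀ n ∈ S, β ≤ |ω.2.1 n|)
        ∧ snr * ∑ t, (∑ n, ω.1 t n *
          (sparseVector S ω.2.1 n - Δ * quantize Δ S ω.2.1 n)) ^ 2 ≤ 1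
        ∧ residual Δ (ω.1, observation S ω) m'
          ≤ residual Δ (ω.1, observation S ω) (quantize Δ S ω.2.1)} with hE
  have hx : ∀ S' : Finset (Fin N), (0 : ℝ) ≤ 1 + (S \ S').card * (snr * β ^ 2 / 32) / T :=
    fun S' => by
      have h : (0 : ℝ) ≤ (S \ S').card := Nat.cast_nonneg _
      generalize ((S \ S').card : ℝ) = i at h
      positivity
  have hnn : ∀ S' : Finset (Fin N), 0 ≤ (2 * (R : ℝ) + 1) ^ K * (Real.exp 1 *
      (1 + (S \ S').card * (snr * β ^ 2 / 32) / T) ^ (-(T / 2) : ℝ)) := fun S' => by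
    have := Real.rpow_nonneg (hx S') (-(T / 2) : ℝ)
    have := Real.exp_pos 1
    exact mul_nonneg (by positivity) (mul_nonneg this.le ‹_›)
  have hsub : {ω : (Fin T → Fin N → ℝ) × (Fin N → ℝ) × (Fin T → ℝ) |
      D.estimate (ω.1, observation S ω) ≠ S}
      ⊆ {ω | ¬ ∀ n ∈ S, β ≤ |ω.2.1 n|} ∪ {ω | (R * Δ) ^ 2 ≤ ∑ n ∈ S, ω.2.1 n ^ 2}
        ∪ {ω | 1 ≤ snr * ∑ t, (∑ n, ω.1 t n *
          (sparseVector S ω.2.1 n - Δ * quantize Δ S ω.2.1 n)) ^ 2}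
        ∪ ⋃ S' ∈ (Finset.powersetCard K (Finset.univ : Finset (Fin N))).erase S,
          ⋃ m' ∈ integerGrid R S', E S' m' := by
    intro ω hω
    by_contra hcon
    simp only [Set.mem_union, not_or, Set.mem_iUnion, not_exists] at hcon
    obtain ⟨⟨⟨h1, h2⟩, h3⟩, h4⟩ := hcon
    refine hω (hD S hS _ ?_)
    simp only [nearestRegion, Set.mem_iUnion, Set.mem_iInter, exists_prop]
    refine ⟨quantize Δ S ω.2.1, quantize_mem_integerGrid hΔ fun n hn => ?_, fun S' hS' m' hm' => ?_⟩
    · refine abs_le_of_sq_le_sq (le_trans ?_ (not_le.1 h2).le) hRΔ.le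
      exact Finset.single_le_sum (f := fun n => ω.2.1 n ^ 2) (fun n _ => sq_nonneg _) hn
    · by_contra h5
      exact h4 S' hS' m' hm' ⟨not_not.1 h1, (not_le.1 h3).le, not_lt.1 h5⟩
  refine ENNReal.toReal_le_of_le_ofReal
    (add_nonneg (by positivity) (Finset.sum_nonneg fun S' _ => hnn S')) ?_
  rw [ENNReal.ofReal_add (by positivity) (Finset.sum_nonneg fun S' _ => hnn S'),
    ENNReal.ofReal_add (by positivity) (by positivity),
    ENNReal.ofReal_sum_of_nonneg fun S' _ => hnn S']
  refine (measure_mono hsub).trans ((measure_union_le _ _).trans (add_le_add ?_ ?_))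
  · refine (measure_union_le _ _).trans (add_le_add ?_ ?_)
    · refine (measure_union_le _ _).trans ?_
      rw [law_coefficient_small snr hβ, zero_add, ← hcard]
      exact law_coefficient_large_le hν snr S (by positivity)
    · rw [← hcard]
      exact law_quantization_error_le ν hT hs hΔ S
  · refine (measure_biUnion_finset_le _ _).trans (Finset.sum_le_sum fun S' hS' => ?_)
    refine (measure_biUnion_finset_le _ _).trans ((Finset.sum_le_sum fun m' hm' =>
      law_residual_le_le ν hT hs hΔ hβΔ S S' hm').trans (le_of_eq ?_))
    rw [Finset.sum_const, card_integerGrid,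
      (Finset.mem_powersetCard.1 (Finset.mem_of_mem_erase hS')).2, ← ENNReal.ofReal_nsmul,
      nsmul_eq_mul]
    push_cast
    rfl

/-! ### Counting competing supports and balancing the union bound. -/

/-- `S'` is determined by `S' \ S`, a set of `i` elements, and `S \ S'`, a subset of `S`. -/
lemma card_filter_card_sdiff_eq_le (S : Finset (Fin N)) (K i : ℕ) :
    ((Finset.powersetCard K (Finset.univ : Finset (Fin N))).filter
      fun S' => S'.card = S.card ∧ (S \ S').card = i).card ≤ N ^ i * 2 ^ S.card := by
  have h1 : (Finset.powersetCard i (Finset.univ : Finset (Fin N)) ×ˢ S.powerset).card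
      ≤ N ^ i * 2 ^ S.card := by
    rw [Finset.card_product, Finset.card_powersetCard, Finset.card_powerset, Finset.card_univ,
      Fintype.card_fin]
    exact Nat.mul_le_mul_right _ (Nat.choose_le_pow N i)
  refine le_trans (Finset.card_le_card_of_injOn (fun S' => (S' \ S, S \ S')) ?_ ?_) h1
  · intro S' hS'
    simp only [Finset.coe_filter, Set.mem_ofPred_eq] at hS'
    have h2 := Finset.card_sdiff_add_card_inter S S'
    have h3 := Finset.card_sdiff_add_card_inter S' S
    rw [Finset.inter_comm] at h3
    simp only [Finset.coe_product, Set.mem_prod, Finset.mem_coe, Finset.mem_powersetCard,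
      Finset.mem_powerset, Finset.subset_univ, true_and, Finset.sdiff_subset, and_true]
    omega
  · intro S₁ _ S₂ _ h
    simp only [Prod.mk.injEq] at h
    ext n
    have h2 := Finset.ext_iff.1 h.1 n
    have h3 := Finset.ext_iff.1 h.2 n
    simp only [Finset.mem_sdiff] at h2 h3
    tauto

/-- The at most `N ^ i * 2 ^ K` supports at distance `i` contribute `2 ^ K / N ^ i ≤ 2 ^ K / N` for
each `i` from `1` to `K`. -/
lemma sum_inv_sq_pow_card_sdiff_le (hN : 1 ≤ N) {K : ℕ} {S : Finset (Fin N)}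
    (hS : S ∈ Finset.powersetCard K (Finset.univ : Finset (Fin N))) :
    ∑ S' ∈ (Finset.powersetCard K (Finset.univ : Finset (Fin N))).erase S,
      (((N : ℝ) ^ 2)⁻¹) ^ (S \ S').card ≤ K * 2 ^ K / N := by
  have hcard := (Finset.mem_powersetCard.1 hS).2
  have hN' : (1 : ℝ) ≤ N := by exact_mod_cast hN
  have hmap : ∀ S' ∈ (Finset.powersetCard K (Finset.univ : Finset (Fin N))).erase S,
      (S \ S').card ∈ Finset.Icc 1 K := fun S' hS' => by
    rw [Finset.mem_erase, Finset.mem_powersetCard] at hS'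
    rw [Finset.mem_Icc, Nat.one_le_iff_ne_zero, Ne, Finset.card_eq_zero,
      Finset.sdiff_eq_empty_iff_subset]
    refine ⟨fun h => hS'.1 (Finset.eq_of_subset_of_card_le h (by omega)).symm, ?_⟩
    rw [← hcard]
    exact Finset.card_le_card Finset.sdiff_subset
  rw [← Finset.sum_fiberwise_of_maps_to hmap]
  calc _ ≤ ∑ i ∈ Finset.Icc 1 K, 2 ^ K / (N : ℝ) := Finset.sum_le_sum fun i hi => by
        rw [Finset.sum_congr rfl fun S' hS' => by rw [(Finset.mem_filter.1 hS').2],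
          Finset.sum_const, nsmul_eq_mul]
        have h1 := card_filter_card_sdiff_eq_le S K i
        rw [hcard] at h1
        have h2 : (((Finset.powersetCard K (Finset.univ : Finset (Fin N))).erase S).filter
            fun S' => (S \ S').card = i).card ≤ N ^ i * 2 ^ K := by
          refine le_trans (Finset.card_le_card fun S' hS' => ?_) h1
          rw [Finset.mem_filter] at hS' ⊢
          have h3 := Finset.mem_of_mem_erase hS'.1
          exact ⟨h3, (Finset.mem_powersetCard.1 h3).2, hS'.2⟩
        have h3 : ((((Finset.powersetCard K (Finset.univ : Finset (Fin N))).erase S).filter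
            fun S' => (S \ S').card = i).card : ℝ) ≤ N ^ i * 2 ^ K := by exact_mod_cast h2
        have h4 : (((N : ℝ) ^ 2)⁻¹) ^ i = ((N : ℝ) ^ i)⁻¹ * ((N : ℝ) ^ i)⁻¹ := by
          rw [← mul_inv, ← mul_pow, ← sq, inv_pow]
        have h5 : (N : ℝ) ≤ N ^ i := le_self_pow₀ hN' (by
          have := (Finset.mem_Icc.1 hi).1; omega)
        calc _ ≤ (N : ℝ) ^ i * 2 ^ K * (((N : ℝ) ^ 2)⁻¹) ^ i := by gcongr
          _ = 2 ^ K / (N : ℝ) ^ i := by rw [h4]; field_simp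
          _ ≤ _ := by gcongr
    _ = _ := by
      rw [Finset.sum_const, Nat.card_Icc, nsmul_eq_mul]
      simp only [add_tsub_cancel_right]
      ring

/-- Here `L` stands for `log N`. Half of the decay exponent pays `2 * i * L`, that is `N ^ (-2 *
i)`; the other half pays the factor `(1 + y) ^ K`. The latter is needed because the grid grows with
`snr`, which has no upper bound; only a power of `L` survives. -/
lemma pow_mul_rpow_le {L β T snr R : ℝ} {K i : ℕ} (hL : 1 ≤ L) (hβ : 0 < β) (hi : 1 ≤ i)
    (hiK : i ≤ K) (hKL : K * Real.log (1 + β ^ 2) ≤ 2 * L)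
    (hT : 8 * K * L / Real.log (1 + β ^ 2) ≤ T) (hs : 256 / Real.log (1 + β ^ 2) * L ≤ snr)
    (hR0 : 0 ≤ R) (hR : R ≤ L ^ 2 * √snr + 1) :
    (2 * R + 1) ^ K * (1 + i * (snr * β ^ 2 / 32) / T) ^ (-(T / 2) : ℝ)
      ≤ (5 * (1 + 256 / (β ^ 2 * Real.log (1 + β ^ 2))) * L ^ 3) ^ K * Real.exp (-(2 * i * L)) := by
  have hℓ : 0 < Real.log (1 + β ^ 2) := Real.log_pos (by have := pow_pos hβ 2; linarith)
  have hL0 : 0 < L := by linarith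
  set ℓ := Real.log (1 + β ^ 2) with hℓ_def
  have hi' : (1 : ℝ) ≤ i := by exact_mod_cast hi
  have hiK' : (i : ℝ) ≤ K := by exact_mod_cast hiK
  have hs0 : 0 < snr := lt_of_lt_of_le (by positivity) hs
  have hT0 : 0 < T := by
    have : (0 : ℝ) < K := by linarith
    exact lt_of_lt_of_le (by positivity) hT
  -- The value of `i * (snr * β ^ 2 / 32) / T` at `T = 8 * i * L / ℓ`, where `i` cancels. The
  -- assumption on `snr` says `y ≥ β ^ 2`.
  set y := snr * β ^ 2 * ℓ / (256 * L) with hy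
  have hy0 : 0 < y := by positivity
  have h1 : 8 * i * L / ℓ * Real.log (1 + y) ≤ T * Real.log (1 + i * (snr * β ^ 2 / 32) / T) := by
    have h2 := mul_log_one_add_div_le (s := 8 * i * L / ℓ) (t := T) (x := i * (snr * β ^ 2 / 32))
      (by positivity) (le_trans (by gcongr) hT) (by positivity)
    have h3 : i * (snr * β ^ 2 / 32) / (8 * i * L / ℓ) = y := by
      rw [hy]; field_simp; norm_num
    rwa [h3] at h2
  have h2 : ℓ ≤ Real.log (1 + y) := by
    refine Real.log_le_log (by positivity) (add_le_add le_rfl ?_)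
    rw [hy, le_div_iff₀ (by positivity)]
    rw [div_mul_eq_mul_div, div_le_iff₀ hℓ] at hs
    have := pow_pos hβ 2
    nlinarith
  have h3 : 2 * i * L + K * Real.log (1 + y) ≤ 4 * i * L / ℓ * Real.log (1 + y) := by
    have h4 : 2 * i * L ≤ 2 * i * L / ℓ * Real.log (1 + y) := by
      rw [div_mul_eq_mul_div, le_div_iff₀ hℓ]
      gcongr
    have h5 : K * Real.log (1 + y) ≤ 2 * i * L / ℓ * Real.log (1 + y) := by
      have : 0 < Real.log (1 + y) := hℓ.trans_le h2
      gcongr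
      rw [le_div_iff₀ hℓ]
      nlinarith
    have h6 : 4 * i * L / ℓ = 2 * i * L / ℓ + 2 * i * L / ℓ := by ring
    rw [h6, add_mul]
    linarith
  have h4 : (1 + i * (snr * β ^ 2 / 32) / T) ^ (-(T / 2) : ℝ)
      ≤ Real.exp (-(2 * i * L)) * ((1 + y) ^ K)⁻¹ := by
    rw [Real.rpow_def_of_pos (by positivity), ← Real.exp_log (by positivity : 0 < 1 + y),
      ← Real.exp_nat_mul, ← Real.exp_neg, ← Real.exp_add]
    refine Real.exp_le_exp.2 ?_
    have h5 : 8 * i * L / ℓ * Real.log (1 + y) = 2 * (4 * i * L / ℓ * Real.log (1 + y)) := by ring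
    linarith
  have h5 : 2 * R + 1 ≤ 5 * (1 + 256 / (β ^ 2 * ℓ)) * L ^ 3 * (1 + y) := by
    have h6 : snr = 256 / (β ^ 2 * ℓ) * (L * y) := by rw [hy]; field_simp
    have h7 : 2 * √snr ≤ 1 + snr := by
      nlinarith [sq_nonneg (1 - √snr), Real.sq_sqrt hs0.le]
    have hk : 0 < 256 / (β ^ 2 * ℓ) := by positivity
    set k := 256 / (β ^ 2 * ℓ)
    have h8 : 1 + snr ≤ (1 + k) * L * (1 + y) := by
      rw [h6]
      nlinarith [mul_pos hk hL0, mul_pos hL0 hy0]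
    have h9 : (1 : ℝ) ≤ L ^ 2 := one_le_pow₀ hL
    calc 2 * R + 1 ≤ L ^ 2 * (2 * √snr) + 3 := by linarith
      _ ≤ L ^ 2 * (1 + snr) + 3 := by gcongr
      _ ≤ 5 * (L ^ 2 * (1 + snr)) := by nlinarith
      _ ≤ 5 * (L ^ 2 * ((1 + k) * L * (1 + y))) := by gcongr
      _ = _ := by ring
  calc _ ≤ (5 * (1 + 256 / (β ^ 2 * ℓ)) * L ^ 3 * (1 + y)) ^ K
        * (Real.exp (-(2 * i * L)) * ((1 + y) ^ K)⁻¹) := by gcongr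
    _ = _ := by
      rw [mul_pow _ (1 + y)]
      field_simp

lemma errorProb_le {ν : Measure ℝ} {K : ℕ} (hK : K ≤ N) {snr B : ℝ} {D : Decoder N T}
    (h : ∀ S ∈ Finset.powersetCard K (Finset.univ : Finset (Fin N)),
      (law ν N T snr).real {ω | D.estimate (ω.1, observation S ω) ≠ S} ≤ B) :
    errorProb ν K snr D ≤ B := by
  have h2 : (0 : ℝ) < N.choose K := by exact_mod_cast Nat.choose_pos hK
  rw [errorProb, ← Finset.mul_sum, one_div, inv_mul_le_iff₀ h2]
  refine (Finset.sum_le_sum h).trans (le_of_eq ?_)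
  rw [Finset.sum_const, Finset.card_powersetCard, Finset.card_univ, Fintype.card_fin, nsmul_eq_mul]

/-! ### The sufficient condition. -/

theorem exists_samples_sufficient : ∃ C : ℝ, 0 < C ∧ ∀ b : ℝ, 0 < b → ∃ a : ℝ, 0 < a ∧
      ∀ (ν : Measure ℝ) (σ : ℝ), 0 < σ → IsCoefficientPrior ν σ →
      (∀ᵐ x ∂ν, b ≤ |x|) →
      ∀ (K : ℕ) (T : ℕ → ℕ) (snr : ℕ → ℝ), IsScaling (fun _ => K) T snr →
        (∀ᶠ N : ℕ in atTop, a * Real.log N ≤ snr N) →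
        IsSufficient ν (fun _ => K) T snr
          (fun N => C * ((K : ℝ) * Real.log ((N : ℝ) / (K : ℝ)) / Real.log (1 + b ^ 2))
            ≤ (T N : ℝ)) := by
  refine ⟨16, by norm_num, fun b hb => ?_⟩
  have hℓ : 0 < Real.log (1 + b ^ 2) := Real.log_pos (by have := pow_pos hb 2; linarith)
  set ℓ := Real.log (1 + b ^ 2)
  refine ⟨256 / ℓ, by positivity, fun ν σ hσ hν hbν K T snr hsc hsnr => ?_⟩
  -- With `L = log N`, the mesh `1 / (L * √snr)` makes the rounding error negligible against the
  -- noise, and the radius gives `R * Δ ≥ L`, so the grid eventually covers the coefficients with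
  -- high probability.
  choose D hD using fun N : ℕ => exists_nearest_decoder (N := N) (T := T N)
    (1 / (Real.log N * √(snr N))) ⌈Real.log N ^ 2 * √(snr N)⌉₊ K
  refine ⟨D, fun ε hε => ?_⟩
  set c₁ := 5 * (1 + 256 / (b ^ 2 * ℓ)) with hc₁
  have hlog : Tendsto (fun N : ℕ => Real.log N) atTop atTop :=
    Real.tendsto_log_atTop.comp tendsto_natCast_atTop_atTop
  have hlim : Tendsto (fun N : ℕ => K * (σ ^ 2 + 1) / Real.log N ^ 2
      + Real.exp 1 * c₁ ^ K * K * 2 ^ K * (Real.log N ^ (3 * K) / N)) atTop (nhds 0) := by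
    have h1 : Tendsto (fun N : ℕ => K * (σ ^ 2 + 1) / Real.log N ^ 2) atTop (nhds 0) :=
      ((tendsto_pow_atTop two_ne_zero).comp hlog).const_div_atTop _
    have h2 : Tendsto (fun N : ℕ => Real.log N ^ (3 * K) / N) atTop (nhds 0) :=
      (Real.isLittleO_pow_log_id_atTop (n := 3 * K)).tendsto_div_nhds_zero.comp
        tendsto_natCast_atTop_atTop
    simpa using h1.add (h2.const_mul _)
  -- The summands ensure in turn `L ≥ 1`, `snr ≥ 1`, `2 * Δ ≤ b`, `K * ℓ ≤ 2 * L` and `L ≤ 2 * log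
  -- (N / K)`. The last one turns the constant `16` into the `8` of `pow_mul_rpow_le`.
  have hL := hlog.eventually_ge_atTop
    (1 + ℓ / 256 + 2 / b + K * ℓ + 2 * Real.log K)
  filter_upwards [hsc, hsnr, hL, hlim.eventually_lt_const hε]
    with N ⟨hK, hKN, hT, hs⟩ hsnr hL hlt hcond
  refine lt_of_le_of_lt (errorProb_le (by omega) fun S hS => ?_) hlt
  have hK' : (1 : ℝ) ≤ K := by exact_mod_cast hK
  have hN' : (0 : ℝ) < N := by
    have : (0 : ℝ) ≤ K := by linarith
    have : 2 * (K : ℝ) < N := by exact_mod_cast hKN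
    linarith
  have hlogK : 0 ≤ Real.log K := Real.log_nonneg hK'
  have hexpL : Real.exp (Real.log N) = N := Real.exp_log hN'
  have hlogNK : Real.log ((N : ℝ) / K) = Real.log N - Real.log K :=
    Real.log_div hN'.ne' (by positivity)
  rw [hlogNK] at hcond
  have hDN := hD N
  set L := Real.log N with hL_def
  have e1 : 0 < ℓ / 256 := by positivity
  have e2 : 0 < 2 / b := by positivity
  have e3 : 0 < K * ℓ := by positivity
  have hL1 : 1 ≤ L := by linarith
  have hs1 : 1 ≤ snr N := by
    refine le_trans ?_ hsnr
    rw [div_mul_eq_mul_div, le_div_iff₀ hℓ]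
    linarith
  have hsq : 1 ≤ √(snr N) := Real.one_le_sqrt.2 hs1
  have hLs : 0 < L * √(snr N) := by positivity
  set Δ := 1 / (L * √(snr N)) with hΔ_def
  have hΔ : 0 < Δ := by positivity
  have hR1 : L ^ 2 * √(snr N) ≤ (⌈L ^ 2 * √(snr N)⌉₊ : ℝ) := Nat.le_ceil _
  have hR2 : (⌈L ^ 2 * √(snr N)⌉₊ : ℝ) ≤ L ^ 2 * √(snr N) + 1 :=
    (Nat.ceil_lt_add_one (by positivity)).le
  have hR3 : 1 ≤ ⌈L ^ 2 * √(snr N)⌉₊ := Nat.one_le_ceil_iff.2 (by positivity)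
  set R := ⌈L ^ 2 * √(snr N)⌉₊
  have hβΔ : 2 * Δ ≤ b := by
    rw [hΔ_def, mul_one_div, div_le_iff₀ hLs]
    have h1 : 2 / b ≤ L := by linarith
    rw [div_le_iff₀ hb] at h1
    nlinarith
  refine (law_real_nearest_ne_le hν hT hs hΔ hβΔ hbν hR3 hDN hS).trans ?_
  refine add_le_add ?_ ?_
  · have h1 : L ≤ R * Δ := by
      calc L = L ^ 2 * √(snr N) * Δ := by rw [hΔ_def]; field_simp
        _ ≤ R * Δ := by gcongr
    have h2 : snr N * (K * Δ ^ 2) = K / L ^ 2 := by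
      rw [hΔ_def, div_pow, mul_pow, Real.sq_sqrt hs.le]
      field_simp
    have h3 : K * σ ^ 2 / (R * Δ) ^ 2 ≤ K * σ ^ 2 / L ^ 2 := by gcongr
    rw [h2, mul_add, mul_one, add_div]
    gcongr
  · have h1 : ∀ S' ∈ (Finset.powersetCard K (Finset.univ : Finset (Fin N))).erase S,
        (2 * (R : ℝ) + 1) ^ K * (Real.exp 1 *
            (1 + (S \ S').card * (snr N * b ^ 2 / 32) / T N) ^ (-(T N / 2) : ℝ))
        ≤ Real.exp 1 * (c₁ * L ^ 3) ^ K * (((N : ℝ) ^ 2)⁻¹) ^ (S \ S').card := fun S' hS' => by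
      rw [Finset.mem_erase, Finset.mem_powersetCard] at hS'
      have hcard := (Finset.mem_powersetCard.1 hS).2
      have hi1 : 1 ≤ (S \ S').card := by
        rw [Nat.one_le_iff_ne_zero, Ne, Finset.card_eq_zero, Finset.sdiff_eq_empty_iff_subset]
        exact fun h => hS'.1 (Finset.eq_of_subset_of_card_le h (by omega)).symm
      have hi2 : (S \ S').card ≤ K := hcard ▸ Finset.card_le_card Finset.sdiff_subset
      generalize (S \ S').card = i at hi1 hi2
      have h2 := pow_mul_rpow_le (K := K) (i := i) hL1 hb hi1 hi2 (by linarith) (T := T N)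
        (snr := snr N) (R := R) ?_ hsnr (by positivity) hR2
      · have h3 : Real.exp (-(2 * i * L)) = (((N : ℝ) ^ 2)⁻¹) ^ i := by
          rw [← hexpL, ← Real.exp_nat_mul, ← Real.exp_neg, ← Real.exp_nat_mul]
          congr 1
          push_cast
          ring
        rw [← h3, mul_left_comm, mul_assoc]
        exact mul_le_mul_of_nonneg_left h2 (Real.exp_pos 1).le
      · refine le_trans ?_ hcond
        rw [mul_div_assoc', div_le_div_iff_of_pos_right hℓ]
        have : L ≤ 2 * (L - Real.log K) := by linarith
        nlinarith
    refine (Finset.sum_le_sum h1).trans ?_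
    rw [← Finset.mul_sum]
    have h2 := sum_inv_sq_pow_card_sdiff_le (by omega : 1 ≤ N) hS
    calc _ ≤ Real.exp 1 * (c₁ * L ^ 3) ^ K * (K * 2 ^ K / N) := by gcongr
      _ = _ := by rw [mul_pow, ← pow_mul]; ring

end SparseRegression

theorem theorem5 :
    -- a signal-to-noise ratio of order at least `log N` is necessary, for every scaling of `K`
    (∃ c : ℝ, 0 < c ∧ ∀ (ν : Measure ℝ) (σ : ℝ), 0 < σ →
      SparseRegression.IsCoefficientPrior ν σ →
      ∀ (K T : ℕ → ℕ) (snr : ℕ → ℝ), SparseRegression.IsScaling K T snr →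
        SparseRegression.IsNecessary ν K T snr
          (fun N => c / σ ^ 2 * Real.log N ≤ snr N)) ∧
    -- necessary number of samples at signal-to-noise ratio of order `log (N / K)`,
    -- for every scaling of `K`
    (∀ A : ℝ, 0 < A → ∃ c : ℝ, 0 < c ∧ ∀ (ν : Measure ℝ) (σ : ℝ), 0 < σ →
      SparseRegression.IsCoefficientPrior ν σ →
      ∀ (K T : ℕ → ℕ) (snr : ℕ → ℝ), SparseRegression.IsScaling K T snr →
        (∀ᶠ N : ℕ in atTop, snr N ≤ A * Real.log ((N : ℝ) / (K N : ℝ))) →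
        SparseRegression.IsNecessary ν K T snr
          (fun N => c * ((K N : ℝ) * Real.log ((N : ℝ) / (K N : ℝ)) / Real.log (1 + σ ^ 2))
            ≤ (T N : ℝ))) ∧
    -- the same at signal-to-noise ratio of order `log N`, for `K ≤ N ^ (1 - η)`
    (∀ A η : ℝ, 0 < A → 0 < η → ∃ c : ℝ, 0 < c ∧ ∀ (ν : Measure ℝ) (σ : ℝ), 0 < σ →
      SparseRegression.IsCoefficientPrior ν σ →
      ∀ (K T : ℕ → ℕ) (snr : ℕ → ℝ), SparseRegression.IsScaling K T snr →
        (∀ᶠ N : ℕ in atTop, (K N : ℝ) ≤ (N : ℝ) ^ (1 - η)) →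
        (∀ᶠ N : ℕ in atTop, snr N ≤ A * Real.log N) →
        SparseRegression.IsNecessary ν K T snr
          (fun N => c * ((K N : ℝ) * Real.log ((N : ℝ) / (K N : ℝ)) / Real.log (1 + σ ^ 2))
            ≤ (T N : ℝ))) ∧
    -- sufficient number of samples at signal-to-noise ratio of order `log N`, for fixed `K`
    (∃ C : ℝ, 0 < C ∧ ∀ b : ℝ, 0 < b → ∃ a : ℝ, 0 < a ∧
      ∀ (ν : Measure ℝ) (σ : ℝ), 0 < σ → SparseRegression.IsCoefficientPrior ν σ →
      (∀ᵐ x ∂ν, b ≤ |x|) →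
      ∀ (K : ℕ) (T : ℕ → ℕ) (snr : ℕ → ℝ), SparseRegression.IsScaling (fun _ => K) T snr →
        (∀ᶠ N : ℕ in atTop, a * Real.log N ≤ snr N) →
        SparseRegression.IsSufficient ν (fun _ => K) T snr
          (fun N => C * ((K : ℝ) * Real.log ((N : ℝ) / (K : ℝ)) / Real.log (1 + b ^ 2))
            ≤ (T N : ℝ))) := by
  exact ⟨SparseRegression.exists_snr_necessary, SparseRegression.exists_samples_necessary,
    SparseRegression.exists_samples_necessary_sublinear,
    SparseRegression.exists_samples_sufficient⟩
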